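/- Let $(W_e)_{e\in\mathbb N}$ be the standard enumeration of the computably enumerable (c.e.) sets, $W_e=\operatorname{dom}\varphi_e$. For relations $E,F$ on $\mathbb N$, $E\le_c F$ means that there is a computable $h:\mathbb N\to\mathbb N$ with $x\,E\,y\iff h(x)\,F\,h(y)$ for all $x,y$, and $E\equiv_c F$ ($E$ and $F$ are computably bi-reducible) means $E\le_c F$ and $F\le_c E$. Let $n\ge 1$. Let $T_n$ be the algebra of terms over the generators $x_0,\dots,x_{n-1}$ in a single unary function symbol $f$, and fix a computable bijective coding of the pairs of terms (identities) in $T_n\times T_n$ by natural numbers. The $e$-th $n$-generated c.e. algebra with one unary function is the quotient $\mathcal A_e=\langle x_0,\dots,x_{n-1}\mid W_e\rangle$ of $T_n$ by the congruence relation generated by the identities whose codes lie in $W_e$. Let $\cong_{n}$ be the isomorphism relation on indices: $e\cong_n i\iff \mathcal A_e\cong\mathcal A_i$. Fix a computable bijective coding by natural numbers of the ordinals below $\omega\cdot n$, each represented by its Cantor normal form $\omega^{e_1}c_1+\dots+\omega^{e_k}c_k$ with $e_1>\dots>e_k$ in $\mathbb N$ and $c_1,\dots,c_k$ positive integers, and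 order $\mathbb N$ by comparing the coded ordinals. Let $e\;E_{\min}(\omega\cdot n)\;i$ hold if and only if $W_e$ and $W_i$ have the same least element in this ordering or are both empty. Proposition. For every $n\ge 1$ and all codings as above, $\cong_n\ \equiv_c\ E_{\min}(\omega\cdot n)$. -/

import Mathlib

namespace CEAlg

/-! ### Computably enumerable sets and computable reducibility -/

/-- The `e`-th partial computable function, in the standard numbering of programs. -/
def phi (e : ℕ) : ℕ →. ℕ :=
  (Denumerable.ofNat Nat.Partrec.Code e).eval

/-- The `e`-th c.e. set, the domain of the `e`-th partial computable function. -/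
def W (e : ℕ) : Set ℕ :=
  {x | (phi e x).Dom}

/-- Computable reducibility of (equivalence) relations on `ℕ`. -/
def ComputablyReducible (E F : ℕ → ℕ → Prop) : Prop :=
  ∃ h : ℕ → ℕ, Computable h ∧ ∀ x y, E x y ↔ F (h x) (h y)

/-- Computable bi-reducibility. -/
def ComputablyBireducible (E F : ℕ → ℕ → Prop) : Prop :=
  ComputablyReducible E F ∧ ComputablyReducible F E

/-! ### The relations `E_min` -/

/-- `a` is the least element of `S` with respect to the (non-strict) order `le`. -/
def IsLeastFor (le : ℕ → ℕ → Prop) (S : Set ℕ) (a : ℕ) : Prop :=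
  a ∈ S ∧ ∀ b ∈ S, le a b

/-- `E_min` of a well-ordering `le` of `ℕ`: the two c.e. sets have the same least element
or are both empty. -/
def EMinOrder (le : ℕ → ℕ → Prop) (e i : ℕ) : Prop :=
  (∃ a, IsLeastFor le (W e) a ∧ IsLeastFor le (W i) a) ∨ (W e = ∅ ∧ W i = ∅)

/-- The list `[(e₁, c₁), …, (eₖ, cₖ)]` is a Cantor normal form (below `ω ^ ω`):
the exponents are strictly decreasing and the coefficients are nonzero. -/
def IsCNF (l : List (ℕ × ℕ)) : Prop :=
  l.Pairwise (fun p q => q.1 < p.1) ∧ ∀ p ∈ l, 0 < p.2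

/-- The ordinal `ω ^ e₁ * c₁ + ⋯ + ω ^ eₖ * cₖ` denoted by `[(e₁, c₁), …, (eₖ, cₖ)]`. -/
noncomputable def cnfValue : List (ℕ × ℕ) → Ordinal.{0}
  | [] => 0
  | p :: l => Ordinal.omega0 ^ (p.1 : Ordinal.{0}) * (p.2 : Ordinal.{0}) + cnfValue l

/-- A bijective and computable coding of the ordinals below `α` (for `α` at most `ω ^ ω`),
represented by their Cantor normal forms, by natural numbers. `equiv` is the decoding
function; it is computable as a map into tuples of natural numbers. -/
structure OrdinalCoding (α : Ordinal.{0}) where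
  equiv : ℕ ≃ {l : List (ℕ × ℕ) // IsCNF l ∧ cnfValue l < α}
  computable : Computable fun m => (equiv m).1

/-- The ordering of `ℕ` of order type `α` that is induced by a coding of the ordinals
below `α`. -/
def OrdinalCoding.le {α : Ordinal.{0}} (h : OrdinalCoding α) (a b : ℕ) : Prop :=
  cnfValue (h.equiv a).1 ≤ cnfValue (h.equiv b).1

/-- `E_min(α)`, formed with the coding `h` of the ordinals below `α`. -/
def EMin {α : Ordinal.{0}} (h : OrdinalCoding α) : ℕ → ℕ → Prop :=
  EMinOrder h.le

/-! ### Algebras with one unary function -/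

/-- An algebra over the signature with exactly one function symbol, which is unary. -/
structure UnaryAlgebra where
  carrier : Type
  op : carrier → carrier

/-- Isomorphism of algebras with one unary function. -/
def UnaryAlgebra.Isomorphic (A B : UnaryAlgebra) : Prop :=
  ∃ g : A.carrier ≃ B.carrier, ∀ a, g (A.op a) = B.op (g a)

/-- Terms over the generators `x₀, …, xₙ₋₁` in one unary function symbol. -/
inductive UTerm (n : ℕ) : Type
  | gen : Fin n → UTerm n
  | app : UTerm n → UTerm n

/-- The generator that occurs in a term. -/
def UTerm.base {n : ℕ} : UTerm n → Fin n
  | .gen i => i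
  | .app t => t.base

/-- The number of function symbols in a term. -/
def UTerm.depth {n : ℕ} : UTerm n → ℕ
  | .gen _ => 0
  | .app t => t.depth + 1

/-- The term `f^k(xᵢ)`. -/
def UTerm.iter {n : ℕ} (i : Fin n) : ℕ → UTerm n
  | 0 => .gen i
  | k + 1 => .app (UTerm.iter i k)

/-- Every term is `f^k(xᵢ)` for exactly one `i` and `k`. -/
def UTerm.equivProd (n : ℕ) : UTerm n ≃ Fin n × ℕ where
  toFun t := (t.base, t.depth)
  invFun p := UTerm.iter p.1 p.2
  left_inv t := by
    induction t with
    | gen i => rfl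
    | app t ih => exact congrArg UTerm.app ih
  right_inv p := by
    obtain ⟨i, k⟩ := p
    induction k with
    | zero => rfl
    | succ k ih =>
      have h := Prod.mk.inj ih
      exact Prod.ext h.1 (congrArg (· + 1) h.2)

/-- The notion of computability on terms. -/
instance (n : ℕ) : Primcodable (UTerm n) :=
  Primcodable.ofEquiv (Fin n × ℕ) (UTerm.equivProd n)

/-- The congruence relation on the term algebra generated by a set `R` of identities. -/
inductive CongGen {n : ℕ} (R : Set (UTerm n × UTerm n)) : UTerm n → UTerm n → Prop
  | of {s t : UTerm n} : (s, t) ∈ R → CongGen R s t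
  | refl (t : UTerm n) : CongGen R t t
  | symm {s t : UTerm n} : CongGen R s t → CongGen R t s
  | trans {s t u : UTerm n} : CongGen R s t → CongGen R t u → CongGen R s u
  | app {s t : UTerm n} : CongGen R s t → CongGen R (.app s) (.app t)

def congSetoid {n : ℕ} (R : Set (UTerm n × UTerm n)) : Setoid (UTerm n) where
  r := CongGen R
  iseqv := ⟨CongGen.refl, CongGen.symm, CongGen.trans⟩

/-- The algebra presented by generators `x₀, …, xₙ₋₁` and the set `R` of identities: the
quotient of the term algebra by the congruence relation generated by `R`. -/
def presented (n : ℕ) (R : Set (UTerm n × UTerm n)) : UnaryAlgebra where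
  carrier := Quotient (congSetoid R)
  op := Quotient.map UTerm.app fun _ _ h => CongGen.app h

/-- A bijective and computable coding of the identities between terms over
`x₀, …, xₙ₋₁` by natural numbers; `equiv` is the decoding function. -/
structure IdentityCoding (n : ℕ) where
  equiv : ℕ ≃ UTerm n × UTerm n
  computable : Computable equiv

/-- The `e`-th `n`-generated c.e. algebra with one unary function: it is presented by the
identities whose codes belong to `W e`. -/
def ceAlgebra {n : ℕ} (c : IdentityCoding n) (e : ℕ) : UnaryAlgebra :=
  presented n (c.equiv '' W e)

/-- The isomorphism relation, on indices, of `n`-generated c.e. algebras with one unary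
function. -/
def IsoUF {n : ℕ} (c : IdentityCoding n) (e i : ℕ) : Prop :=
  (ceAlgebra c e).Isomorphic (ceAlgebra c i)


/-! ### The codings exist -/

theorem omega_mul_add_inj {a b c d : ℕ}
    (h : Ordinal.omega0 * (a : Ordinal.{0}) + b = Ordinal.omega0 * (c : Ordinal.{0}) + d) :
    a = c ∧ b = d := by
  have key : ∀ a b : ℕ, (Ordinal.omega0 * (a : Ordinal.{0}) + b) / Ordinal.omega0 = a ∧
      (Ordinal.omega0 * (a : Ordinal.{0}) + b) % Ordinal.omega0 = b := by
    intro a b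
    constructor
    · rw [Ordinal.mul_add_div _ Ordinal.omega0_ne_zero,
        Ordinal.div_eq_zero_of_lt (Ordinal.natCast_lt_omega0 b), add_zero]
    · rw [Ordinal.mul_add_mod_self, Ordinal.mod_eq_of_lt (Ordinal.natCast_lt_omega0 b)]
  have h1 := (key a b).1
  have h2 := (key a b).2
  rw [h] at h1 h2
  rw [(key c d).1] at h1
  rw [(key c d).2] at h2
  exact ⟨by exact_mod_cast h1.symm, by exact_mod_cast h2.symm⟩

/-- The normal form of `ω ^ e * k`. -/
def cnfTerm (e k : ℕ) : List (ℕ × ℕ) := if k = 0 then [] else [(e, k)]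

/-- The normal form of `ω * k + j`. -/
def cnfPair (k j : ℕ) : List (ℕ × ℕ) := cnfTerm 1 k ++ cnfTerm 0 j

theorem cnfPair_isCNF (k j : ℕ) : IsCNF (cnfPair k j) := by
  unfold cnfPair cnfTerm IsCNF
  rcases Nat.eq_zero_or_pos k with hk | hk <;> rcases Nat.eq_zero_or_pos j with hj | hj <;>
    simp [*, Nat.ne_of_gt]

theorem cnfValue_cnfPair (k j : ℕ) :
    cnfValue (cnfPair k j) = Ordinal.omega0 * (k : Ordinal.{0}) + j := by
  unfold cnfPair cnfTerm
  by_cases hk : k = 0 <;> by_cases hj : j = 0 <;> simp [*, cnfValue]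

theorem exists_cnfPair {n : ℕ} {l : List (ℕ × ℕ)} (hl : IsCNF l)
    (h : cnfValue l < Ordinal.omega0 * (n : Ordinal.{0})) : ∃ k j, k < n ∧ l = cnfPair k j := by
  suffices H : ∃ k j, l = cnfPair k j by
    obtain ⟨k, j, rfl⟩ := H
    refine ⟨k, j, ?_, rfl⟩
    by_contra hk
    rw [cnfValue_cnfPair] at h
    have : Ordinal.omega0 * (n : Ordinal.{0}) ≤ Ordinal.omega0 * (k : Ordinal.{0}) := by
      gcongr; exact_mod_cast not_lt.1 hk
    exact absurd (h.trans_le (this.trans le_self_add)) (lt_irrefl _)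
  rcases l with _ | ⟨⟨e, c⟩, l⟩
  · exact ⟨0, 0, rfl⟩
  obtain ⟨hs, hp⟩ := hl
  have hc : 0 < c := hp (e, c) (by simp)
  rw [List.pairwise_cons] at hs
  have he : e < 2 := by
    by_contra he
    have h1 : Ordinal.omega0 ^ (2 : ℕ) ≤ Ordinal.omega0 ^ (e : Ordinal.{0}) := by
      rw [← Ordinal.opow_natCast]
      exact Ordinal.opow_le_opow_right Ordinal.omega0_pos (by exact_mod_cast not_lt.1 he)
    have h2 : Ordinal.omega0 ^ (e : Ordinal.{0}) ≤
        Ordinal.omega0 ^ (e : Ordinal.{0}) * (c : Ordinal.{0}) := by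
      conv_lhs => rw [← mul_one (Ordinal.omega0 ^ (e : Ordinal.{0}))]
      gcongr; exact_mod_cast hc
    have h3 : Ordinal.omega0 * (n : Ordinal.{0}) ≤ Ordinal.omega0 ^ (2 : ℕ) := by
      rw [pow_two]; gcongr; exact (Ordinal.natCast_lt_omega0 n).le
    have h4 : Ordinal.omega0 ^ (e : Ordinal.{0}) * (c : Ordinal.{0}) ≤ cnfValue ((e, c) :: l) :=
      le_self_add
    exact absurd (h.trans_le (h3.trans (h1.trans (h2.trans h4)))) (lt_irrefl _)
  have htail : e = 0 → l = [] := by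
    rintro rfl
    rcases l with _ | ⟨q, l⟩
    · rfl
    · exact absurd (hs.1 q (by simp)) (by simp)
  obtain rfl | rfl : e = 0 ∨ e = 1 := by omega
  · rw [htail rfl]
    exact ⟨0, c, by simp [cnfPair, cnfTerm, hc.ne']⟩
  · rcases l with _ | ⟨⟨e', j⟩, l⟩
    · exact ⟨c, 0, by simp [cnfPair, cnfTerm, hc.ne']⟩
    · have he' : e' = 0 := by have := hs.1 (e', j) (by simp); simpa using this
      subst he'
      have hj : 0 < j := hp (0, j) (by simp)
      rcases l with _ | ⟨q, l⟩
      · exact ⟨c, j, by simp [cnfPair, cnfTerm, hc.ne', hj.ne']⟩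
      · have := hs.2
        rw [List.pairwise_cons] at this
        exact absurd (this.1 q (by simp)) (by simp)

theorem primrec_cnfTerm (e : ℕ) : Primrec (cnfTerm e) := by
  unfold cnfTerm
  exact Primrec.ite (PrimrecRel.comp Primrec.eq Primrec.id (Primrec.const 0)) (Primrec.const [])
    (Primrec.list_cons.comp (Primrec.pair (Primrec.const e) Primrec.id) (Primrec.const []))

/-- Codings as in the definition of `E_min(ω·n)` exist for `n ≥ 1`. -/
theorem nonempty_ordinalCoding (n : ℕ) (hn : 1 ≤ n) :
    Nonempty (OrdinalCoding (Ordinal.omega0 * (n : Ordinal.{0}))) := by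
  let f : ℕ → {l : List (ℕ × ℕ) // IsCNF l ∧ cnfValue l < Ordinal.omega0 * (n : Ordinal.{0})} :=
    fun m => ⟨cnfPair (m % n) (m / n), cnfPair_isCNF _ _, by
      rw [cnfValue_cnfPair]
      calc Ordinal.omega0 * ((m % n : ℕ) : Ordinal.{0}) + ((m / n : ℕ) : Ordinal.{0})
          < Ordinal.omega0 * ((m % n : ℕ) : Ordinal.{0}) + Ordinal.omega0 := by
            gcongr; exact Ordinal.natCast_lt_omega0 _
        _ = Ordinal.omega0 * ((m % n + 1 : ℕ) : Ordinal.{0}) := by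
            push_cast; rw [mul_add, mul_one]
        _ ≤ _ := by
            gcongr; exact_mod_cast Nat.mod_lt m hn⟩
  have hf : Function.Bijective f := by
    constructor
    · intro a b hab
      have h1 : cnfPair (a % n) (a / n) = cnfPair (b % n) (b / n) := congrArg Subtype.val hab
      have h2 := congrArg cnfValue h1
      rw [cnfValue_cnfPair, cnfValue_cnfPair] at h2
      obtain ⟨h3, h4⟩ := omega_mul_add_inj h2
      rw [← Nat.mod_add_div a n, ← Nat.mod_add_div b n, h3, h4]
    · rintro ⟨l, hl, hv⟩
      obtain ⟨k, j, hk, rfl⟩ := exists_cnfPair hl hv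
      refine ⟨k + n * j, Subtype.ext ?_⟩
      change cnfPair ((k + n * j) % n) ((k + n * j) / n) = _
      rw [Nat.add_mul_mod_self_left, Nat.mod_eq_of_lt hk, Nat.add_mul_div_left _ _ hn,
        Nat.div_eq_of_lt hk, zero_add]
  refine ⟨⟨Equiv.ofBijective f hf, ?_⟩⟩
  change Computable fun m => cnfTerm 1 (m % n) ++ cnfTerm 0 (m / n)
  exact (Primrec.list_append.comp
    ((primrec_cnfTerm 1).comp (Primrec.nat_mod.comp Primrec.id (Primrec.const n)))
    ((primrec_cnfTerm 0).comp (Primrec.nat_div.comp Primrec.id (Primrec.const n)))).to_comp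

/-- Codings of identities exist for `n ≥ 1`. -/
theorem nonempty_identityCoding (n : ℕ) (hn : 1 ≤ n) : Nonempty (IdentityCoding n) := by
  have : NeZero n := ⟨by omega⟩
  let g : ℕ ≃ UTerm n :=
    (Nat.divModEquiv n).trans ((Equiv.prodComm _ _).trans (UTerm.equivProd n).symm)
  have hg : Computable g := by
    have h1 : Computable fun m : ℕ => (((Nat.divModEquiv n) m).2, m / n) := by
      refine (Primrec.pair ?_ (Primrec.nat_div.comp Primrec.id (Primrec.const n))).to_comp
      refine Primrec.fin_val_iff.1 ?_
      refine (Primrec.nat_mod.comp Primrec.id (Primrec.const n)).of_eq fun m => ?_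
      simp [Nat.divModEquiv]
    exact (Primrec.of_equiv_symm (e := UTerm.equivProd n)).to_comp.comp h1
  refine ⟨⟨Nat.pairEquiv.symm.trans (g.prodCongr g), ?_⟩⟩
  have hu : Computable Nat.unpair := Primrec.unpair.to_comp
  exact (hg.comp (Computable.fst.comp hu)).pair (hg.comp (Computable.snd.comp hu))

end CEAlg

/-! Represent the term `f^d(xᵢ)` by the number `i + n * d`. Then `f` is `x ↦ x + n`, and an
`n`-generated algebra is a congruence on `ℕ` for this shift. In the window `[n * d, n * d + n)`,
count the numbers not congruent to a smaller one. The counts do not increase with `d`; once they are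
constant from `d` on, the congruence is generated by its restriction to the numbers below `n * (d +
1)` (`shiftCl_eq_of_newCount_const`). So every algebra is finitely presented and has a rank, the
limit of the counts, which is less than `n` unless the congruence is equality.

Finite presentations are attached to ordinals `ω * k + j` with `k < n` so that every proper quotient
of a coded algebra has a smaller code (`exists_smaller_code`): either the rank falls below `k`, or
the same window suffices and more identities hold, which lowers `j`. To an index `e` assign the c.e.
set of codes of algebras that map onto the `e`-th algebra. This set is an isomorphism invariant. At
its least element the surjection is injective, since otherwise its kernel would yield a smaller code
of an algebra that still maps onto the given one (`shiftIso_of_minimal`). So the least element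
determines the algebra, and the empty set can arise only from the free algebra.

Conversely, for each `ω * k + j` in `W e` impose `f^(j+1)(xₖ) = f^j(xₖ)` and `xᵢ = f^j(xₖ)` for `i >
k`. The identities of the least ordinal imply all the others, so the result has `k` free generators
and a tail of length `j` ending in a fixed point (`shiftCl_iff_tailNF`). Both `k` and `j` are
isomorphism invariants (`rank_le_of_shiftIso`, `tail_le_of_shiftIso`), and the empty set gives the
free algebra. -/

namespace CEAlg

/-! ### Closure properties of c.e. predicates. -/

section RecursivelyEnumerable

variable {α β : Type*} [Primcodable α] [Primcodable β]

theorem rePred_of_exists {Q : α → ℕ → Prop} (hQ : PrimrecRel Q) :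
    REPred fun a => ∃ z, Q a z := by
  classical
  have h : Partrec fun a => Nat.rfind fun z => Part.some (decide (Q a z)) :=
    Partrec.rfind (hQ.decide.to_comp.partrec)
  refine h.dom_re.of_eq fun a => ?_
  refine Nat.rfind_dom.trans ?_
  simp

/-- Kleene's normal form; the witness is a bound for the bounded evaluation `evaln` of a program for
`p`. -/
theorem exists_primrecRel_of_rePred {p : α → Prop} (hp : REPred p) :
    ∃ Q : α → ℕ → Prop, PrimrecRel Q ∧ ∀ a, p a ↔ ∃ z, Q a z := by
  obtain ⟨c, hc⟩ := Nat.Partrec.Code.exists_code.1 hp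
  refine ⟨fun a z => (Nat.Partrec.Code.evaln z c (Encodable.encode a)).isSome = true, ?_, ?_⟩
  · refine PrimrecRel.comp Primrec.eq (Primrec.option_isSome.comp
      (Nat.Partrec.Code.primrec_evaln.comp ((Primrec.snd.pair (Primrec.const c)).pair
        (Primrec.encode.comp Primrec.fst)))) (Primrec.const true)
  · intro a
    have h1 : p a ↔ (c.eval (Encodable.encode a)).Dom := by
      rw [hc]
      simp [Part.assert]
    rw [h1, Part.dom_iff_mem]
    constructor
    · rintro ⟨y, hy⟩
      obtain ⟨k, hk⟩ := Nat.Partrec.Code.evaln_complete.1 hy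
      exact ⟨k, Option.isSome_iff_exists.2 ⟨y, hk⟩⟩
    · rintro ⟨k, hk⟩
      obtain ⟨y, hy⟩ := Option.isSome_iff_exists.1 hk
      exact ⟨y, Nat.Partrec.Code.evaln_sound hy⟩

theorem rePred_comp {p : β → Prop} (hp : REPred p) {f : α → β} (hf : Computable f) :
    REPred fun a => p (f a) :=
  Partrec.comp (f := fun b => Part.assert (p b) fun _ => Part.some ()) hp hf

theorem rePred_of_primrec {p : α → Prop} (hp : PrimrecPred p) : REPred p :=
  hp.computablePred.to_re

theorem rePred_eq [DecidableEq β] {f g : α → β} (hf : Computable f) (hg : Computable g) :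
    REPred fun a => f a = g a :=
  rePred_comp (rePred_of_primrec (PrimrecRel.comp Primrec.eq Primrec.fst Primrec.snd))
    (hf.pair hg)

theorem rePred_and {p q : α → Prop} (hp : REPred p) (hq : REPred q) :
    REPred fun a => p a ∧ q a := by
  obtain ⟨P, hP, hp⟩ := exists_primrecRel_of_rePred hp
  obtain ⟨Q, hQ, hq⟩ := exists_primrecRel_of_rePred hq
  have hu := Primrec.unpair.comp (Primrec.snd (α := α) (β := ℕ))
  have h1 : PrimrecRel fun (a : α) (z : ℕ) => P a z.unpair.1 ∧ Q a z.unpair.2 :=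
    PrimrecPred.and (hP.comp Primrec.fst (Primrec.fst.comp hu))
      (hQ.comp Primrec.fst (Primrec.snd.comp hu))
  refine (rePred_of_exists h1).of_eq fun a => ?_
  rw [hp, hq]
  constructor
  · rintro ⟨z, h, h'⟩
    exact ⟨⟨_, h⟩, ⟨_, h'⟩⟩
  · rintro ⟨⟨x, hx⟩, ⟨y, hy⟩⟩
    exact ⟨Nat.pair x y, by simpa using ⟨hx, hy⟩⟩

theorem rePred_or {p q : α → Prop} (hp : REPred p) (hq : REPred q) :
    REPred fun a => p a ∨ q a := by
  obtain ⟨P, hP, hp⟩ := exists_primrecRel_of_rePred hp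
  obtain ⟨Q, hQ, hq⟩ := exists_primrecRel_of_rePred hq
  have h1 : PrimrecRel fun (a : α) (z : ℕ) => P a z ∨ Q a z := PrimrecPred.or hP hQ
  refine (rePred_of_exists h1).of_eq fun a => ?_
  rw [hp, hq, exists_or]

theorem rePred_exists {p : α → β → Prop} (hp : REPred fun x : α × β => p x.1 x.2) :
    REPred fun a => ∃ b, p a b := by
  classical
  obtain ⟨Q, hQ, hp⟩ := exists_primrecRel_of_rePred hp
  have hu := Primrec.unpair.comp (Primrec.snd (α := α) (β := ℕ))
  -- One number packs the code of `b` with the witness for `p a b`; numbers whose first part decodes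
  -- to nothing are rejected.
  let g : α × ℕ → Bool := fun x =>
    Option.casesOn (Encodable.decode (α := β) x.2.unpair.1) false
      fun b => decide (Q (x.1, b) x.2.unpair.2)
  have hg : Primrec g := by
    refine Primrec.option_casesOn (Primrec.decode.comp (Primrec.fst.comp hu)) (Primrec.const false)
      (hQ.decide.comp ((Primrec.fst.comp Primrec.fst).pair Primrec.snd)
        (Primrec.snd.comp (hu.comp Primrec.fst)))
  have h1 : PrimrecRel fun (a : α) (z : ℕ) => g (a, z) = true :=
    PrimrecRel.comp Primrec.eq hg (Primrec.const true)
  refine (rePred_of_exists h1).of_eq fun a => ?_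
  constructor
  · rintro ⟨z, hz⟩
    simp only [g] at hz
    cases hd : (Encodable.decode (α := β) z.unpair.1) with
    | none => simp [hd] at hz
    | some b =>
      simp only [hd, decide_eq_true_eq] at hz
      exact ⟨b, (hp (a, b)).2 ⟨_, hz⟩⟩
  · rintro ⟨b, hb⟩
    obtain ⟨z, hz⟩ := (hp (a, b)).1 hb
    exact ⟨Nat.pair (Encodable.encode b) z, by simpa [g] using hz⟩

theorem rePred_forall_mem {p : α → β → Prop} (hp : REPred fun x : α × β => p x.1 x.2)
    {l : α → List β} (hl : Computable l) : REPred fun a => ∀ b ∈ l a, p a b := by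
  obtain ⟨Q, hQ, hp⟩ := exists_primrecRel_of_rePred hp
  have h1 : PrimrecRel fun (z : ℕ) (x : α × β) => ∃ y < z, Q x y :=
    (PrimrecRel.exists_mem_list (R := fun y x => Q x y)
      (hQ.comp Primrec.snd Primrec.fst)).comp (Primrec.list_range.comp Primrec.fst) Primrec.snd
      |>.of_eq fun _ => by simp
  have h2 : PrimrecRel fun (b : β) (x : α × ℕ) => ∃ y < x.2, Q (x.1, b) y :=
    h1.comp (Primrec.snd.comp Primrec.snd) ((Primrec.fst.comp Primrec.snd).pair Primrec.fst)
  -- Finitely many witnesses have a common bound `z`, which leaves only bounded quantifiers behind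
  -- one unbounded search.
  have h3 : PrimrecRel fun (x : List β × α) (z : ℕ) => ∀ b ∈ x.1, ∃ y < z, Q (x.2, b) y :=
    h2.forall_mem_list.comp (Primrec.fst.comp Primrec.fst)
      ((Primrec.snd.comp Primrec.fst).pair Primrec.snd)
  refine (rePred_comp (rePred_of_exists h3) (hl.pair Computable.id)).of_eq fun a => ?_
  simp only [id, fun b => hp (a, b)]
  constructor
  · rintro ⟨z, hz⟩ b hb
    obtain ⟨y, -, hy⟩ := hz b hb
    exact ⟨y, hy⟩
  · generalize l a = L
    induction L with
    | nil => intro _; exact ⟨0, by simp⟩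
    | cons b L ih =>
      intro H
      obtain ⟨z, hz⟩ := ih fun b' hb' => H b' (List.mem_cons_of_mem _ hb')
      obtain ⟨y, hy⟩ := H b List.mem_cons_self
      refine ⟨max z (y + 1), fun b' hb' => ?_⟩
      rcases List.mem_cons.1 hb' with rfl | hb'
      · exact ⟨y, lt_max_of_lt_right (Nat.lt_succ_self y), hy⟩
      · obtain ⟨w, hw, hq⟩ := hz b' hb'
        exact ⟨w, lt_max_of_lt_left hw, hq⟩

/-- The end of the path with the given edges and starting point, if these fit together. -/
def pathEnd (x : ℕ) (l : List (ℕ × ℕ)) : Option ℕ :=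
  l.foldl (fun o q => if o = some q.1 then some q.2 else none) (some x)

theorem primrec_pathEnd : Primrec₂ pathEnd := by
  refine Primrec.list_foldl (α := ℕ × List (ℕ × ℕ)) (β := ℕ × ℕ) (σ := Option ℕ)
    (f := fun p => p.2) (g := fun p => some p.1)
    (h := fun _ x => if x.1 = some x.2.1 then some x.2.2 else none)
    Primrec.snd (Primrec.option_some.comp Primrec.fst) ?_
  refine Primrec.ite (PrimrecRel.comp Primrec.eq (Primrec.fst.comp Primrec.snd)
    (Primrec.option_some.comp (Primrec.fst.comp (Primrec.snd.comp Primrec.snd))))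
    (Primrec.option_some.comp (Primrec.snd.comp (Primrec.snd.comp Primrec.snd)))
    (Primrec.const none)

theorem pathEnd_append (x : ℕ) (l : List (ℕ × ℕ)) (q : ℕ × ℕ) :
    pathEnd x (l ++ [q]) = if pathEnd x l = some q.1 then some q.2 else none := by
  simp only [pathEnd, List.foldl_append, List.foldl_cons, List.foldl_nil]
  congr

/-- A path is stored as its list of edges: membership of the edges in `r` becomes a quantifier over
a list, and whether they fit together is primitive recursive. -/
theorem reflTransGen_iff_exists_path {r : ℕ → ℕ → Prop} {x y : ℕ} :
    Relation.ReflTransGen r x y ↔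
      ∃ l : List (ℕ × ℕ), (∀ q ∈ l, r q.1 q.2) ∧ pathEnd x l = some y := by
  constructor
  · intro h
    induction h with
    | refl => exact ⟨[], by simp, rfl⟩
    | @tail u v _ huv ih =>
      obtain ⟨l, hl, he⟩ := ih
      refine ⟨l ++ [(u, v)], ?_, by rw [pathEnd_append, he]; simp⟩
      intro q hq
      rcases List.mem_append.1 hq with hq | hq
      · exact hl q hq
      · rw [List.mem_singleton.1 hq]; exact huv
  · rintro ⟨l, hl, he⟩
    induction l using List.reverseRecOn generalizing y with
    | nil =>
      simp only [pathEnd, List.foldl_nil, Option.some.injEq] at he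
      subst he; exact .refl
    | append_singleton l q ih =>
      rw [pathEnd_append] at he
      split_ifs at he with h
      simp only [Option.some.injEq] at he
      subst he
      exact .tail (ih (fun q' hq' => hl q' (by simp [hq'])) h) (hl q (by simp))

theorem rePred_reflTransGen {r : α → ℕ → ℕ → Prop}
    (hr : REPred fun x : α × (ℕ × ℕ) => r x.1 x.2.1 x.2.2) {f g : α → ℕ} (hf : Computable f)
    (hg : Computable g) : REPred fun a => Relation.ReflTransGen (r a) (f a) (g a) := by
  simp only [reflTransGen_iff_exists_path]
  refine rePred_exists (β := List (ℕ × ℕ)) (rePred_and ?_ ?_)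
  · refine rePred_forall_mem (α := α × List (ℕ × ℕ)) (β := ℕ × ℕ)
      (p := fun x q => r x.1 q.1 q.2) (l := fun x => x.2) ?_ Computable.snd
    exact rePred_comp hr ((Computable.fst.comp Computable.fst).pair Computable.snd)
  · exact rePred_eq (primrec_pathEnd.to_comp.comp (hf.comp Computable.fst) Computable.snd)
      (Computable.option_some.comp (hg.comp Computable.fst))

end RecursivelyEnumerable

/-! ### Uniform enumerations and the s-m-n theorem. -/

theorem rePred_mem_W {α : Type*} [Primcodable α] {f g : α → ℕ} (hf : Computable f)
    (hg : Computable g) : REPred fun a => f a ∈ W (g a) := by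
  have h : Partrec fun a => phi (g a) (f a) :=
    Nat.Partrec.Code.eval_part.comp ((Computable.ofNat _).comp hg) hf
  exact h.dom_re

/-- Every uniformly recursively enumerable sequence of sets can be read off from the standard
numbering of the c.e. sets. -/
theorem exists_computable_W_eq {p : ℕ → ℕ → Prop} (hp : REPred fun x : ℕ × ℕ => p x.1 x.2) :
    ∃ h : ℕ → ℕ, Computable h ∧ ∀ e, W (h e) = {x | p e x} := by
  obtain ⟨c, hc⟩ := Nat.Partrec.Code.exists_code.1 hp
  refine ⟨fun e => Encodable.encode (c.curry e), ?_, fun e => ?_⟩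
  · exact (Primrec.encode.comp
      (Nat.Partrec.Code.primrec₂_curry.comp (Primrec.const c) Primrec.id)).to_comp
  · ext x
    simp only [W, phi, Set.mem_ofPred_eq, Denumerable.ofNat_encode, Nat.Partrec.Code.eval_curry, hc]
    have : Encodable.decode (α := ℕ × ℕ) (Nat.pair e x) = some (e, x) := by
      simp
    rw [this]
    simp [Part.assert]

/-! ### Congruences on the natural numbers with the operation `x ↦ x + n`

The term `f^d(xᵢ)` is represented by the number `i + n * d`. -/

structure IsShiftCong (n : ℕ) (θ : ℕ → ℕ → Prop) : Prop where
  equivalence : Equivalence θ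
  shift : ∀ {x y}, θ x y → θ (x + n) (y + n)

namespace IsShiftCong

variable {n : ℕ} {θ : ℕ → ℕ → Prop} (hθ : IsShiftCong n θ)
include hθ

theorem rfl {x : ℕ} : θ x x := hθ.equivalence.refl x

theorem symm {x y : ℕ} (h : θ x y) : θ y x := hθ.equivalence.symm h

theorem trans {x y z : ℕ} (h : θ x y) (h' : θ y z) : θ x z := hθ.equivalence.trans h h'

theorem shift_mul {x y : ℕ} (h : θ x y) (d : ℕ) : θ (x + n * d) (y + n * d) := by
  induction d with
  | zero => simpa using h
  | succ d ih => simpa [Nat.mul_succ, ← Nat.add_assoc] using hθ.shift ih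

end IsShiftCong

/-- `x` and `y` are related by a translate of a pair in `R` or of its converse. -/
def ShiftStep (n : ℕ) (R : ℕ → ℕ → Prop) (x y : ℕ) : Prop :=
  ∃ a b d, (R a b ∨ R b a) ∧ x = a + n * d ∧ y = b + n * d

/-- The congruence generated by `R`. -/
def shiftCl (n : ℕ) (R : ℕ → ℕ → Prop) : ℕ → ℕ → Prop :=
  Relation.ReflTransGen (ShiftStep n R)

theorem shiftCl_of {n : ℕ} {R : ℕ → ℕ → Prop} {x y : ℕ} (h : R x y) : shiftCl n R x y :=
  .single ⟨x, y, 0, .inl h, rfl, rfl⟩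

theorem isShiftCong_shiftCl (n : ℕ) (R : ℕ → ℕ → Prop) : IsShiftCong n (shiftCl n R) where
  equivalence := by
    refine ⟨fun _ => .refl, fun {x y} h => ?_, fun h h' => h.trans h'⟩
    have : Std.Symm (ShiftStep n R) := ⟨fun x y ⟨a, b, d, h, hx, hy⟩ => ⟨b, a, d, h.symm, hy, hx⟩⟩
    exact (Relation.ReflTransGen.stdSymm (r := ShiftStep n R)).symm x y h
  shift := by
    intro x y h
    refine Relation.ReflTransGen.lift (· + n) ?_ _ _ h
    rintro x y ⟨a, b, d, h, rfl, rfl⟩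
    exact ⟨a, b, d + 1, h, by ring, by ring⟩

theorem shiftCl_le {n : ℕ} {R θ : ℕ → ℕ → Prop} (hθ : IsShiftCong n θ)
    (h : ∀ x y, R x y → θ x y) {x y : ℕ} (hxy : shiftCl n R x y) : θ x y := by
  induction hxy with
  | refl => exact hθ.rfl
  | tail _ hs ih =>
    obtain ⟨a, b, d, hab, rfl, rfl⟩ := hs
    refine hθ.trans ih (hθ.shift_mul ?_ d)
    exact hab.elim (h a b) fun h' => hθ.symm (h b a h')

/-- `n`-generated algebras, given by congruences, are isomorphic. -/
def ShiftIso (n : ℕ) (θ θ' : ℕ → ℕ → Prop) : Prop :=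
  ∃ φ : ℕ → ℕ, (∀ x, φ (x + n) = φ x + n) ∧ (∀ x y, θ x y ↔ θ' (φ x) (φ y)) ∧
    ∀ y, ∃ x, θ' (φ x) y

/-- The second algebra is a homomorphic image of the first one. -/
def ShiftOnto (n : ℕ) (θ θ' : ℕ → ℕ → Prop) : Prop :=
  ∃ φ : ℕ → ℕ, (∀ x, φ (x + n) = φ x + n) ∧ (∀ x y, θ x y → θ' (φ x) (φ y)) ∧
    ∀ y, ∃ x, θ' (φ x) y

theorem map_add_mul {n : ℕ} {φ : ℕ → ℕ} (h : ∀ x, φ (x + n) = φ x + n) (x d : ℕ) :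
    φ (x + n * d) = φ x + n * d := by
  induction d with
  | zero => simp
  | succ d ih => rw [Nat.mul_succ, ← Nat.add_assoc, h, ih, Nat.add_assoc]

theorem map_eq_mod_add {n : ℕ} {φ : ℕ → ℕ} (h : ∀ x, φ (x + n) = φ x + n) (x : ℕ) :
    φ x = φ (x % n) + n * (x / n) := by
  rw [← map_add_mul h, Nat.mod_add_div]

theorem ShiftIso.onto {n : ℕ} {θ θ' : ℕ → ℕ → Prop} (h : ShiftIso n θ θ') : ShiftOnto n θ θ' := by
  obtain ⟨φ, h1, h2, h3⟩ := h
  exact ⟨φ, h1, fun x y => (h2 x y).1, h3⟩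

theorem ShiftIso.trans {n : ℕ} {θ θ' θ'' : ℕ → ℕ → Prop} (hθ'' : IsShiftCong n θ'')
    (h : ShiftIso n θ θ') (h' : ShiftIso n θ' θ'') : ShiftIso n θ θ'' := by
  obtain ⟨φ, h1, h2, h3⟩ := h
  obtain ⟨ψ, h1', h2', h3'⟩ := h'
  refine ⟨ψ ∘ φ, fun x => by simp [h1, h1'], fun x y => (h2 x y).trans (h2' _ _), fun z => ?_⟩
  obtain ⟨y, hy⟩ := h3' z
  obtain ⟨x, hx⟩ := h3 y
  exact ⟨x, hθ''.trans ((h2' _ _).1 hx) hy⟩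

theorem ShiftOnto.trans {n : ℕ} {θ θ' θ'' : ℕ → ℕ → Prop} (hθ'' : IsShiftCong n θ'')
    (h : ShiftOnto n θ θ') (h' : ShiftOnto n θ' θ'') : ShiftOnto n θ θ'' := by
  obtain ⟨φ, h1, h2, h3⟩ := h
  obtain ⟨ψ, h1', h2', h3'⟩ := h'
  refine ⟨ψ ∘ φ, fun x => by simp [h1, h1'], fun x y h => h2' _ _ (h2 x y h), fun z => ?_⟩
  obtain ⟨y, hy⟩ := h3' z
  obtain ⟨x, hx⟩ := h3 y
  exact ⟨x, hθ''.trans (h2' _ _ hx) hy⟩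

theorem ShiftIso.symm {n : ℕ} (hn : 1 ≤ n) {θ θ' : ℕ → ℕ → Prop} (hθ' : IsShiftCong n θ')
    (h : ShiftIso n θ θ') : ShiftIso n θ' θ := by
  obtain ⟨φ, h1, h2, h3⟩ := h
  choose g hg using h3
  -- Arbitrarily chosen preimages need not commute with the shift, so they are used for the
  -- generators only and extended freely.
  let ψ : ℕ → ℕ := fun y => g (y % n) + n * (y / n)
  have hψ : ∀ y, θ' (φ (ψ y)) y := by
    intro y
    simp only [ψ]
    rw [map_add_mul h1]
    have := hθ'.shift_mul (hg (y % n)) (y / n)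
    rwa [Nat.mod_add_div] at this
  refine ⟨ψ, fun y => ?_, fun x y => ?_, fun x => ⟨φ x, (h2 _ _).2 (hψ _)⟩⟩
  · simp only [ψ, Nat.add_mod_right, Nat.add_div_right y hn]
    ring
  · rw [h2]
    exact ⟨fun h => hθ'.trans (hθ'.trans (hψ x) h) (hθ'.symm (hψ y)),
      fun h => hθ'.trans (hθ'.trans (hθ'.symm (hψ x)) h) (hψ y)⟩

/-! ### Terms as natural numbers -/

def UTerm.toNat {n : ℕ} (t : UTerm n) : ℕ := t.base + n * t.depth

theorem UTerm.toNat_app {n : ℕ} (t : UTerm n) : t.app.toNat = t.toNat + n := by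
  simp only [toNat, base, depth]; ring

/-- The relation between numbers that corresponds to a set of identities. -/
def identityRel {n : ℕ} (R : Set (UTerm n × UTerm n)) (x y : ℕ) : Prop :=
  ∃ p ∈ R, p.1.toNat = x ∧ p.2.toNat = y

theorem UTerm.toNat_bijective {n : ℕ} (hn : 1 ≤ n) : Function.Bijective (@UTerm.toNat n) := by
  constructor
  · intro s t h
    have hs := s.base.2
    have ht := t.base.2
    simp only [toNat] at h
    have h1 := congrArg (· % n) h
    have h2 := congrArg (· / n) h
    simp only [Nat.add_mul_mod_self_left, Nat.mod_eq_of_lt hs, Nat.mod_eq_of_lt ht,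
      Nat.add_mul_div_left _ _ hn, Nat.div_eq_of_lt hs, Nat.div_eq_of_lt ht, zero_add] at h1 h2
    exact (UTerm.equivProd n).injective (Prod.ext (Fin.ext h1) h2)
  · intro x
    refine ⟨(UTerm.equivProd n).symm (⟨x % n, Nat.mod_lt _ hn⟩, x / n), ?_⟩
    have h := (UTerm.equivProd n).apply_symm_apply (⟨x % n, Nat.mod_lt _ hn⟩, x / n)
    have h1 := (Prod.ext_iff.1 h).1
    have h2 := (Prod.ext_iff.1 h).2
    change UTerm.base _ = _ at h1
    change UTerm.depth _ = _ at h2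
    simp only [toNat]
    rw [h1, h2, Nat.mod_add_div]

/-- Both sides are least congruences containing the identities, and `UTerm.toNat` carries `app` to
the shift. -/
theorem congGen_iff {n : ℕ} (hn : 1 ≤ n) (R : Set (UTerm n × UTerm n)) (s t : UTerm n) :
    CongGen R s t ↔ shiftCl n (identityRel R) s.toNat t.toNat := by
  have hc := isShiftCong_shiftCl n (identityRel R)
  constructor
  · intro h
    induction h with
    | of h => exact shiftCl_of ⟨_, h, rfl, rfl⟩
    | refl => exact hc.rfl
    | symm _ ih => exact hc.symm ih
    | trans _ _ ih ih' => exact hc.trans ih ih'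
    | app _ ih => rw [UTerm.toNat_app, UTerm.toNat_app]; exact hc.shift ih
  · intro h
    let e := Equiv.ofBijective _ (UTerm.toNat_bijective hn)
    have he : ∀ t, e.symm (UTerm.toNat t) = t := e.symm_apply_apply
    have happ : ∀ x, e.symm (x + n) = (e.symm x).app := fun x => by
      rw [Equiv.symm_apply_eq]
      change _ = UTerm.toNat _
      rw [UTerm.toNat_app]
      exact congrArg (· + n) (e.apply_symm_apply x).symm
    have hθ : IsShiftCong n fun x y => CongGen R (e.symm x) (e.symm y) :=
      ⟨⟨fun _ => .refl _, .symm, .trans⟩, fun h => by simpa only [happ] using h.app⟩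
    have := shiftCl_le hθ (fun x y h => by
      obtain ⟨p, hp, rfl, rfl⟩ := h
      rw [he, he]; exact .of hp) h
    rwa [he, he] at this

theorem presented_isomorphic_iff {n : ℕ} (hn : 1 ≤ n) (R R' : Set (UTerm n × UTerm n)) :
    (presented n R).Isomorphic (presented n R') ↔
      ShiftIso n (shiftCl n (identityRel R)) (shiftCl n (identityRel R')) := by
  let e := Equiv.ofBijective _ (UTerm.toNat_bijective hn)
  have he : ∀ x, UTerm.toNat (e.symm x) = x := e.apply_symm_apply
  have hes : ∀ t, e.symm (UTerm.toNat t) = t := e.symm_apply_apply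
  let q : UTerm n → (presented n R).carrier := Quotient.mk (congSetoid R)
  let q' : UTerm n → (presented n R').carrier := Quotient.mk (congSetoid R')
  have hq : ∀ s t, q s = q t ↔ shiftCl n (identityRel R) s.toNat t.toNat := fun s t =>
    (Quotient.eq (r := congSetoid R)).trans (congGen_iff hn R s t)
  have hq' : ∀ s t, q' s = q' t ↔ shiftCl n (identityRel R') s.toNat t.toNat := fun s t =>
    (Quotient.eq (r := congSetoid R')).trans (congGen_iff hn R' s t)
  have hqs : Function.Surjective q := Quotient.mk_surjective
  have hqs' : Function.Surjective q' := Quotient.mk_surjective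
  have hqo : ∀ t, (presented n R).op (q t) = q t.app := fun _ => rfl
  have hqo' : ∀ t, (presented n R').op (q' t) = q' t.app := fun _ => rfl
  constructor
  · rintro ⟨g, hg⟩
    choose r hr using fun i : ℕ => hqs' (g (q (e.symm i)))
    -- The term algebra is free, so representatives of the images of the generators determine a lift
    -- of `g`.
    let φ : ℕ → ℕ := fun x => (r (x % n)).toNat + n * (x / n)
    have hφ : ∀ x, φ (x + n) = φ x + n := fun x => by
      simp only [φ, Nat.add_mod_right, Nat.add_div_right x hn]
      ring
    have hlift : ∀ i d, i < n → q' (e.symm (φ (i + n * d))) = g (q (e.symm (i + n * d))) := by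
      intro i d hi
      have happ : ∀ x, e.symm (x + n) = (e.symm x).app := fun x => by
        rw [Equiv.symm_apply_eq]
        change _ = UTerm.toNat _
        rw [UTerm.toNat_app, he]
      induction d with
      | zero => simp [φ, Nat.mod_eq_of_lt hi, Nat.div_eq_of_lt hi, hes, hr]
      | succ d ih =>
        have h1 : i + n * (d + 1) = i + n * d + n := by ring
        rw [h1, hφ, happ, happ, ← hqo', ih, ← hqo, hg]
    have hl : ∀ x, q' (e.symm (φ x)) = g (q (e.symm x)) := fun x => by
      have := hlift (x % n) (x / n) (Nat.mod_lt _ hn)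
      rwa [Nat.mod_add_div] at this
    refine ⟨φ, hφ, fun x y => ?_, fun y => ?_⟩
    · have h1 := hq (e.symm x) (e.symm y)
      have h2 := hq' (e.symm (φ x)) (e.symm (φ y))
      rw [he, he] at h1 h2
      rw [← h1, ← h2, hl, hl, g.injective.eq_iff]
    · obtain ⟨a, ha⟩ := g.surjective (q' (e.symm y))
      obtain ⟨s, rfl⟩ := hqs a
      refine ⟨s.toNat, ?_⟩
      have h2 := hq' (e.symm (φ s.toNat)) (e.symm y)
      rw [he, he] at h2
      rw [← h2, hl, hes, ha]
  · rintro ⟨φ, h1, h2, h3⟩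
    let G : UTerm n → UTerm n := fun t => e.symm (φ t.toNat)
    have hG : ∀ t, (G t).toNat = φ t.toNat := fun t => he _
    have hqG : ∀ s t, q s = q t ↔ q' (G s) = q' (G t) := fun s t => by
      rw [hq, hq', hG, hG, h2]
    let g : (presented n R).carrier → (presented n R').carrier :=
      Quotient.lift (s := congSetoid R) (fun t => q' (G t)) fun s t h =>
        (hqG s t).1 (Quotient.sound (s := congSetoid R) h)
    have hg : ∀ t, g (q t) = q' (G t) := fun _ => rfl
    have hgb : Function.Bijective g := by
      constructor
      · intro a b hab
        obtain ⟨s, rfl⟩ := hqs a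
        obtain ⟨t, rfl⟩ := hqs b
        exact (hqG s t).2 hab
      · intro b
        obtain ⟨t, rfl⟩ := hqs' b
        obtain ⟨x, hx⟩ := h3 t.toNat
        refine ⟨q (e.symm x), ?_⟩
        rw [hg, hq', hG, he]
        exact hx
    refine ⟨Equiv.ofBijective g hgb, fun a => ?_⟩
    obtain ⟨t, rfl⟩ := hqs a
    change g ((presented n R).op (q t)) = (presented n R').op (g (q t))
    rw [hqo, hg, hg, hqo', hq', hG, UTerm.toNat_app, UTerm.toNat_app, h1, hG]
    exact (isShiftCong_shiftCl _ _).rfl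

/-- The congruence that defines the `e`-th algebra. -/
def ceCong {n : ℕ} (c : IdentityCoding n) (e : ℕ) : ℕ → ℕ → Prop :=
  shiftCl n (identityRel (c.equiv '' W e))

theorem isShiftCong_ceCong {n : ℕ} (c : IdentityCoding n) (e : ℕ) : IsShiftCong n (ceCong c e) :=
  isShiftCong_shiftCl _ _

theorem isoUF_iff {n : ℕ} (hn : 1 ≤ n) (c : IdentityCoding n) (e i : ℕ) :
    IsoUF c e i ↔ ShiftIso n (ceCong c e) (ceCong c i) :=
  presented_isomorphic_iff hn _ _

/-! ### Enumerability of the congruences, uniformly in the index. -/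

theorem primrec_toNat (n : ℕ) : Primrec (@UTerm.toNat n) := by
  have h : Primrec (UTerm.equivProd n) := Primrec.of_equiv
  exact (Primrec.nat_add.comp (Primrec.fin_val.comp (Primrec.fst.comp h))
    (Primrec.nat_mul.comp (Primrec.const n) (Primrec.snd.comp h)))

theorem rePred_ceCong {n : ℕ} (c : IdentityCoding n) {α : Type*} [Primcodable α] {e f g : α → ℕ}
    (he : Computable e) (hf : Computable f) (hg : Computable g) :
    REPred fun a => ceCong c (e a) (f a) (g a) := by
  have hR : REPred fun x : ℕ × (ℕ × ℕ) => identityRel (c.equiv '' W x.1) x.2.1 x.2.2 := by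
    have : REPred fun x : ℕ × (ℕ × ℕ) => ∃ i : ℕ, i ∈ W x.1 ∧
        (c.equiv i).1.toNat = x.2.1 ∧ (c.equiv i).2.toNat = x.2.2 := by
      have hc : Computable fun x : (ℕ × (ℕ × ℕ)) × ℕ => c.equiv x.2 :=
        c.computable.comp Computable.snd
      have ht := (primrec_toNat n).to_comp
      have hx : Computable fun x : (ℕ × (ℕ × ℕ)) × ℕ => x.1.2 :=
        Computable.snd.comp Computable.fst
      exact rePred_exists (rePred_and (rePred_mem_W Computable.snd
        (Computable.fst.comp Computable.fst)) (rePred_and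
        (rePred_eq (ht.comp (Computable.fst.comp hc)) (Computable.fst.comp hx))
        (rePred_eq (ht.comp (Computable.snd.comp hc)) (Computable.snd.comp hx))))
    refine this.of_eq fun x => ?_
    simp only [identityRel, Set.exists_mem_image]
  refine rePred_reflTransGen (r := fun a => ShiftStep n (identityRel (c.equiv '' W (e a)))) ?_ hf hg
  let β := (((α × (ℕ × ℕ)) × ℕ) × ℕ) × ℕ
  have hA : Computable fun z : β => z.1.1.2 := Computable.snd.comp (Computable.fst.comp
    Computable.fst)
  have hB : Computable fun z : β => z.1.2 := Computable.snd.comp Computable.fst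
  have hD : Computable fun z : β => z.2 := Computable.snd
  have hX : Computable fun z : β => z.1.1.1 := Computable.fst.comp (Computable.fst.comp
    Computable.fst)
  have hE : Computable fun z : β => e z.1.1.1.1 := he.comp (Computable.fst.comp hX)
  have hlin : Computable₂ fun a d : ℕ => a + n * d :=
    (Primrec.nat_add.comp Primrec.fst (Primrec.nat_mul.comp (Primrec.const n) Primrec.snd)).to_comp
  refine rePred_exists (rePred_exists (rePred_exists (rePred_and (rePred_or ?_ ?_)
    (rePred_and ?_ ?_))))
  · exact rePred_comp hR (hE.pair (hA.pair hB))
  · exact rePred_comp hR (hE.pair (hB.pair hA))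
  · exact rePred_eq (Computable.fst.comp (Computable.snd.comp hX)) (hlin.comp hA hD)
  · exact rePred_eq (Computable.snd.comp (Computable.snd.comp hX)) (hlin.comp hB hD)

/-! ### Congruences of given rank -/

/-- `t` is not related to a smaller number. -/
def IsNew (θ : ℕ → ℕ → Prop) (t : ℕ) : Prop := ∀ s < t, ¬ θ s t

open Classical in
/-- The number of those `t` in `[n * d, n * d + n)` that are not related to a smaller number. -/
noncomputable def newCount (n : ℕ) (θ : ℕ → ℕ → Prop) (d : ℕ) : ℕ :=
  ((Finset.range n).filter fun i => IsNew θ (i + n * d)).card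

/-- A smaller relative of `t` shifts to a smaller relative of `t + n`. This makes the counts
decrease along the windows. -/
theorem IsShiftCong.isNew_of_add {n : ℕ} {θ : ℕ → ℕ → Prop} (hθ : IsShiftCong n θ) {t : ℕ}
    (h : IsNew θ (t + n)) : IsNew θ t :=
  fun s hs hst => h (s + n) (by omega) (hθ.shift hst)

theorem newCount_antitone {n : ℕ} {θ : ℕ → ℕ → Prop} (hθ : IsShiftCong n θ) :
    Antitone (newCount n θ) := by
  classical
  refine antitone_nat_of_succ_le fun d => ?_
  refine Finset.card_le_card (Finset.monotone_filter_right _ fun i _ h => ?_)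
  refine hθ.isNew_of_add ?_
  convert h using 1; ring

theorem newCount_mono {n : ℕ} {θ θ' : ℕ → ℕ → Prop} (h : ∀ x y, θ x y → θ' x y) (d : ℕ) :
    newCount n θ' d ≤ newCount n θ d := by
  classical
  exact Finset.card_le_card (Finset.monotone_filter_right _ fun _ _ hi s hs hst => hi s hs (h _ _ hst))

theorem exists_newCount_eventually_const {n : ℕ} {θ : ℕ → ℕ → Prop} (hθ : IsShiftCong n θ) :
    ∃ d, ∀ d' ≥ d, newCount n θ d' = newCount n θ d := by
  classical
  let P : ℕ → Prop := fun k => ∃ d, newCount n θ d = k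
  have hP : ∃ k, P k := ⟨_, 0, rfl⟩
  obtain ⟨d, hd⟩ := Nat.find_spec hP
  refine ⟨d, fun d' h => le_antisymm (newCount_antitone hθ h) ?_⟩
  rw [hd]
  exact Nat.find_min' hP ⟨d', rfl⟩

/-- If the number of new elements does not decrease any more, a congruence is generated by its
restriction to an initial segment. -/
theorem shiftCl_eq_of_newCount_const {n : ℕ} (hn : 1 ≤ n) {θ R : ℕ → ℕ → Prop}
    (hθ : IsShiftCong n θ) {d : ℕ} (hd : ∀ d' ≥ d, newCount n θ d' = newCount n θ d)
    (hR : ∀ x y, R x y → θ x y)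
    (hR' : ∀ x y, x < y → y < n * (d + 1) → θ x y → R x y) (x y : ℕ) :
    shiftCl n R x y ↔ θ x y := by
  have hc := isShiftCong_shiftCl n R
  refine ⟨shiftCl_le hθ hR, ?_⟩
  -- From window `d` on, the residues of new elements form a decreasing chain of finite sets of
  -- equal size, hence a constant one.
  have hnew : ∀ t, n * (d + 1) ≤ t → IsNew θ (t - n) → IsNew θ t := by
    intro t ht h
    have hq : d + 1 ≤ t / n := (Nat.le_div_iff_mul_le hn).2 (by rwa [Nat.mul_comm])
    obtain ⟨q, hq'⟩ : ∃ q, t / n = q + 1 := ⟨t / n - 1, by omega⟩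
    have ht' : t = t % n + n * (q + 1) := by rw [← hq', Nat.mod_add_div]
    have htn : t - n = t % n + n * q := by rw [Nat.mul_succ] at ht'; omega
    have heq : newCount n θ (q + 1) = newCount n θ q := by
      rw [hd _ (by omega), hd q (by omega)]
    classical
    have hsub : (Finset.range n).filter (fun i => IsNew θ (i + n * (q + 1))) ⊆
        (Finset.range n).filter fun i => IsNew θ (i + n * q) := by
      refine Finset.monotone_filter_right _ fun i _ h => hθ.isNew_of_add ?_
      convert h using 1; ring
    have hset := Finset.eq_of_subset_of_card_le hsub (by
      unfold newCount at heq
      convert heq.ge)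
    have hmem : t % n ∈ (Finset.range n).filter fun i => IsNew θ (i + n * q) := by
      rw [Finset.mem_filter, ← htn]
      exact ⟨Finset.mem_range.2 (Nat.mod_lt _ hn), h⟩
    rw [← hset, Finset.mem_filter, ← ht'] at hmem
    exact hmem.2
  -- Descent to the least element of the class using `R` only. Below `n * (d + 1)` one pair of `R`
  -- suffices. Beyond that, a `t` that is not new has `t - n` not new, so shifting the
  -- representative of `t - n` gives a relative strictly below `t`.
  have hrep : ∀ t, ∃ m, IsNew θ m ∧ m ≤ t ∧ θ m t ∧ shiftCl n R m t := by
    intro t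
    induction t using Nat.strong_induction_on with
    | _ t ih =>
      by_cases hN : IsNew θ t
      · exact ⟨t, hN, le_rfl, hθ.rfl, hc.rfl⟩
      obtain ⟨s, hst, hθs, hcs⟩ : ∃ s < t, θ s t ∧ shiftCl n R s t := by
        by_cases ht : t < n * (d + 1)
        · simp only [IsNew, not_forall, not_not] at hN
          obtain ⟨s, hs, hst⟩ := hN
          exact ⟨s, hs, hst, shiftCl_of (hR' s t hs ht hst)⟩
        · rw [not_lt] at ht
          have hnt : n ≤ t := le_trans (Nat.le_mul_of_pos_right n (Nat.succ_pos d)) ht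
          obtain ⟨m, hm, hmt, hθm, hcm⟩ := ih (t - n) (by omega)
          have hne : m ≠ t - n := by
            rintro rfl
            exact hN (hnew t ht hm)
          have h1 := hθ.shift hθm
          have h2 := hc.shift hcm
          rw [Nat.sub_add_cancel hnt] at h1 h2
          exact ⟨m + n, by omega, h1, h2⟩
      obtain ⟨m, hm, hms, hθm, hcm⟩ := ih s hst
      exact ⟨m, hm, by omega, hθ.trans hθm hθs, hc.trans hcm hcs⟩
  intro hxy
  obtain ⟨m, hm, -, hθm, hcm⟩ := hrep x
  obtain ⟨m', hm', -, hθm', hcm'⟩ := hrep y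
  have hmm : θ m m' := hθ.trans (hθ.trans hθm hxy) (hθ.symm hθm')
  obtain h | rfl | h := lt_trichotomy m m'
  · exact absurd hmm (hm' m h)
  · exact hc.trans (hc.symm hcm) hcm'
  · exact absurd (hθ.symm hmm) (hm m' h)

/-! ### Coding of finite presentations -/

/-- The finite relation coded by the binary digits of `b`. -/
def maskRel (b x y : ℕ) : Prop := b.testBit (Nat.pair x y) = true

/-- The number of bits in the code of a relation on the numbers below `n * (d + 1)`. -/
def maskLen (n d : ℕ) : ℕ := (n * (d + 1)) ^ 2

/-- For all but `k` of the numbers `t` in `[n * d, n * d + n)`, the relation coded by `b` relates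
a smaller number to `t`. -/
def Admissible (n k d b : ℕ) : Prop :=
  ((Finset.range n).filter fun i =>
    ∀ s < i + n * d, b.testBit (Nat.pair s (i + n * d)) = false).card ≤ k

/-- In the block with number `k`, the number `j` codes the relation with code `b` on the numbers
below `n * (d + 1)`. Larger relations get smaller numbers. -/
def IsPresentationCode (n k j d b : ℕ) : Prop :=
  k < n ∧ b < 2 ^ maskLen n d ∧ j + b + 1 = 2 ^ (maskLen n d + 1) ∧ Admissible n k d b

theorem exists_mask (P : ℕ → Prop) (m : ℕ) :
    ∃ b < 2 ^ m, ∀ i, b.testBit i = true ↔ i < m ∧ P i := by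
  classical
  refine ⟨Nat.ofBits fun i : Fin m => decide (P i), Nat.ofBits_lt_two_pow _, fun i => ?_⟩
  by_cases hi : i < m
  · simp [Nat.testBit_ofBits_lt _ _ hi, hi]
  · simp [Nat.testBit_ofBits_ge _ _ (not_lt.1 hi), hi]

theorem pair_lt_maskLen {n d x y : ℕ} (hxy : x < y) (hy : y < n * (d + 1)) :
    Nat.pair x y < maskLen n d := by
  refine (Nat.pair_lt_max_add_one_sq x y).trans_le ?_
  rw [max_eq_right hxy.le]
  exact Nat.pow_le_pow_left hy 2

theorem window_lt {n i d : ℕ} (hi : i < n) : i + n * d < n * (d + 1) := by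
  rw [Nat.mul_succ]; omega

/-- Since `b < 2 ^ maskLen n d`, the number `j` lies in `[2 ^ maskLen n d, 2 ^ (maskLen n d + 1))`.
Its binary logarithm therefore gives `d`, and then `j` gives `b`. -/
theorem IsPresentationCode.unique {n k j d b k' d' b' : ℕ} (hn : 1 ≤ n)
    (h : IsPresentationCode n k j d b) (h' : IsPresentationCode n k' j d' b') :
    d = d' ∧ b = b' := by
  obtain ⟨-, h1, h2, -⟩ := h
  obtain ⟨-, h1', h2', -⟩ := h'
  rw [pow_succ] at h2 h2'
  have hl : Nat.log 2 j = maskLen n d :=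
    (Nat.log_eq_iff (.inr ⟨by omega, by have := Nat.one_le_two_pow (n := maskLen n d); omega⟩)).2
      ⟨by omega, by rw [pow_succ]; omega⟩
  have hl' : Nat.log 2 j = maskLen n d' :=
    (Nat.log_eq_iff (.inr ⟨by omega, by have := Nat.one_le_two_pow (n := maskLen n d'); omega⟩)).2
      ⟨by omega, by rw [pow_succ]; omega⟩
  rw [hl] at hl'
  have hd : d = d' := by
    have h3 := Nat.pow_left_injective two_ne_zero hl'
    have := Nat.eq_of_mul_eq_mul_left hn h3
    omega
  subst hd
  exact ⟨rfl, by omega⟩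

/-- The restriction of a congruence to an initial segment is admissible. -/
theorem admissible_of_mask {n d b : ℕ} {θ : ℕ → ℕ → Prop}
    (hb : ∀ i, b.testBit i = true ↔ i < maskLen n d ∧ θ i.unpair.1 i.unpair.2) :
    Admissible n (newCount n θ d) d b := by
  classical
  refine Finset.card_le_card fun i hi => ?_
  rw [Finset.mem_filter] at hi ⊢
  refine ⟨hi.1, fun s hs hst => ?_⟩
  have := (hb (Nat.pair s (i + n * d))).2
    ⟨pair_lt_maskLen hs (window_lt (Finset.mem_range.1 hi.1)), by simpa using hst⟩
  rw [hi.2 s hs] at this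
  exact absurd this (by simp)

theorem newCount_le_of_admissible {n k d b : ℕ} (h : Admissible n k d b) :
    newCount n (shiftCl n (maskRel b)) d ≤ k := by
  classical
  refine le_trans (Finset.card_le_card fun i hi => ?_) h
  rw [Finset.mem_filter] at hi ⊢
  refine ⟨hi.1, fun s hs => ?_⟩
  by_contra hb
  exact hi.2 s hs (shiftCl_of (by simpa [maskRel] using hb))

theorem shiftCl_mask_iff {n d b : ℕ} (hn : 1 ≤ n) {θ : ℕ → ℕ → Prop} (hθ : IsShiftCong n θ)
    (hd : ∀ d' ≥ d, newCount n θ d' = newCount n θ d)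
    (hb : ∀ i, b.testBit i = true ↔ i < maskLen n d ∧ θ i.unpair.1 i.unpair.2) (x y : ℕ) :
    shiftCl n (maskRel b) x y ↔ θ x y := by
  refine shiftCl_eq_of_newCount_const hn hθ hd (fun x y h => ?_) (fun x y hxy hy h => ?_) x y
  · simpa using ((hb _).1 h).2
  · exact (hb _).2 ⟨pair_lt_maskLen hxy hy, by simpa using h⟩

theorem exists_code_add {n d b : ℕ} (hb : b < 2 ^ maskLen n d) :
    ∃ j, j + b + 1 = 2 ^ (maskLen n d + 1) :=
  ⟨2 ^ (maskLen n d + 1) - b - 1, by rw [pow_succ]; omega⟩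

theorem newCount_lt_of_ne_eq {n : ℕ} (hn : 1 ≤ n) {θ : ℕ → ℕ → Prop} (hθ : IsShiftCong n θ)
    {x y : ℕ} (hxy : x < y) (h : θ x y) {d : ℕ} (hd : y / n ≤ d) : newCount n θ d < n := by
  refine (newCount_antitone hθ hd).trans_lt ?_
  classical
  have hss : (Finset.range n).filter (fun i => IsNew θ (i + n * (y / n))) ⊂ Finset.range n := by
    refine Finset.filter_ssubset.2 ⟨y % n, Finset.mem_range.2 (Nat.mod_lt _ hn), fun hnew => ?_⟩
    rw [Nat.mod_add_div] at hnew
    exact hnew x hxy h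
  have := Finset.card_lt_card hss
  rw [Finset.card_range] at this
  unfold newCount
  convert this

/-- Every congruence has a code in the block whose number is its rank. -/
theorem exists_isPresentationCode {n : ℕ} (hn : 1 ≤ n) {θ : ℕ → ℕ → Prop} (hθ : IsShiftCong n θ)
    {d : ℕ} (hd : ∀ d' ≥ d, newCount n θ d' = newCount n θ d) (hlt : newCount n θ d < n) :
    ∃ j b, IsPresentationCode n (newCount n θ d) j d b ∧
      ∀ x y, shiftCl n (maskRel b) x y ↔ θ x y := by
  obtain ⟨b, hb2, hb⟩ := exists_mask (fun i => θ i.unpair.1 i.unpair.2) (maskLen n d)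
  obtain ⟨j, hj⟩ := exists_code_add hb2
  exact ⟨j, b, ⟨hlt, hb2, hj, admissible_of_mask hb⟩, shiftCl_mask_iff hn hθ hd hb⟩

/-- A congruence that properly contains a coded one has a smaller code. -/
theorem exists_smaller_code {n k j d b : ℕ} (hn : 1 ≤ n) (h : IsPresentationCode n k j d b)
    {θ : ℕ → ℕ → Prop} (hθ : IsShiftCong n θ) (hle : ∀ x y, shiftCl n (maskRel b) x y → θ x y)
    (hne : ∃ x y, θ x y ∧ ¬ shiftCl n (maskRel b) x y) :
    ∃ k' j' d' b', IsPresentationCode n k' j' d' b' ∧ (k' < k ∨ k' = k ∧ j' < j) ∧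
      ∀ x y, shiftCl n (maskRel b') x y ↔ θ x y := by
  obtain ⟨hkn, hb2, hj, hadm⟩ := h
  have hck : newCount n θ d ≤ k := (newCount_mono hle d).trans (newCount_le_of_admissible hadm)
  obtain ⟨d₀, hd₀⟩ := exists_newCount_eventually_const hθ
  have hle₀ : newCount n θ d₀ ≤ newCount n θ d := by
    rw [← hd₀ (max d d₀) (le_max_right _ _)]
    exact newCount_antitone hθ (le_max_left _ _)
  -- If the rank of `θ` is below `k`, any presentation of `θ` moves to an earlier block. If it
  -- equals `k`, the count in window `d` is squeezed to `k`, so it is already stable there and the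
  -- old `d` can be kept.
  rcases (hle₀.trans hck).lt_or_eq with hlt | heq
  · obtain ⟨j', b', hcode, hcl⟩ := exists_isPresentationCode hn hθ hd₀ (hlt.trans hkn)
    exact ⟨_, j', d₀, b', hcode, .inl hlt, hcl⟩
  · have hk : newCount n θ d = k := by omega
    have hd : ∀ d' ≥ d, newCount n θ d' = newCount n θ d := by
      intro d' hdd
      refine le_antisymm (newCount_antitone hθ hdd) ?_
      rw [hk, ← heq, ← hd₀ (max d' d₀) (le_max_right _ _)]
      exact newCount_antitone hθ (le_max_left _ _)
    obtain ⟨b', hb2', hb'⟩ := exists_mask (fun i => θ i.unpair.1 i.unpair.2) (maskLen n d)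
    obtain ⟨j', hj'⟩ := exists_code_add hb2'
    have hcl := shiftCl_mask_iff hn hθ hd hb'
    -- More identities mean more binary digits, hence a larger mask; as `j + b` is fixed by `d`, the
    -- code `j'` is smaller.
    have hbb : b ≤ b' := Nat.le_of_testBit fun i hi => by
      refine (hb' i).2 ⟨?_, hle _ _ (shiftCl_of (by simpa [maskRel] using hi))⟩
      by_contra hlt
      rw [Nat.testBit_lt_two_pow (hb2.trans_le (Nat.pow_le_pow_right two_pos (not_lt.1 hlt)))] at hi
      exact absurd hi (by simp)
    have hbne : b ≠ b' := by
      rintro rfl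
      obtain ⟨x, y, hxy, hn⟩ := hne
      exact hn ((hcl x y).2 hxy)
    exact ⟨k, j', d, b', ⟨hkn, hb2', hj', hk ▸ admissible_of_mask hb'⟩, .inr ⟨rfl, by omega⟩, hcl⟩

/-! ### The presentations of which a given algebra is a homomorphic image -/

/-- `(k, j)` codes a presentation of an algebra that has the algebra given by `θ` as a
homomorphic image. -/
def CoversAt (n : ℕ) (θ : ℕ → ℕ → Prop) (k j : ℕ) : Prop :=
  ∃ d b, IsPresentationCode n k j d b ∧ ShiftOnto n (shiftCl n (maskRel b)) θ

theorem CoversAt.of_iso {n : ℕ} {θ θ' : ℕ → ℕ → Prop} (hθ' : IsShiftCong n θ')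
    (h : ShiftIso n θ θ') {k j : ℕ} (hk : CoversAt n θ k j) : CoversAt n θ' k j := by
  obtain ⟨d, b, hc, ho⟩ := hk
  exact ⟨d, b, hc, ho.trans hθ' h.onto⟩

/-- If the covering map were not injective, its kernel would properly contain the coded congruence.
The kernel then has a smaller code, and the same map shows that this code covers `θ`. -/
theorem shiftIso_of_minimal {n : ℕ} (hn : 1 ≤ n) {θ : ℕ → ℕ → Prop} (hθ : IsShiftCong n θ)
    {k j d b : ℕ} (hc : IsPresentationCode n k j d b) (hk : CoversAt n θ k j)
    (hmin : ∀ k' j', CoversAt n θ k' j' → ¬ (k' < k ∨ k' = k ∧ j' < j)) :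
    ShiftIso n (shiftCl n (maskRel b)) θ := by
  obtain ⟨d', b', hc', φ, h1, h2, h3⟩ := hk
  obtain ⟨rfl, rfl⟩ := hc.unique hn hc'
  have hker : IsShiftCong n fun x y => θ (φ x) (φ y) :=
    ⟨⟨fun _ => hθ.rfl, hθ.symm, hθ.trans⟩, fun h => by rw [h1, h1]; exact hθ.shift h⟩
  refine ⟨φ, h1, fun x y => ⟨h2 x y, fun hxy => ?_⟩, h3⟩
  by_contra hn'
  obtain ⟨k', j', d', b', hcode, hlt, hcl⟩ :=
    exists_smaller_code hn hc hker h2 ⟨x, y, hxy, hn'⟩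
  exact hmin k' j' ⟨d', b', hcode, φ, h1, fun x y => (hcl x y).1, h3⟩ hlt

theorem exists_coversAt {n : ℕ} (hn : 1 ≤ n) {θ : ℕ → ℕ → Prop} (hθ : IsShiftCong n θ)
    {x y : ℕ} (hxy : x ≠ y) (h : θ x y) : ∃ k j, CoversAt n θ k j := by
  obtain ⟨d, hd⟩ := exists_newCount_eventually_const hθ
  obtain ⟨x, y, hxy, h⟩ : ∃ x y, x < y ∧ θ x y := by
    rcases hxy.lt_or_gt with hlt | hlt
    · exact ⟨x, y, hlt, h⟩
    · exact ⟨y, x, hlt, hθ.symm h⟩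
  have hlt : newCount n θ d < n := by
    -- The window of `y` misses a new element, so a window past both `d` and `y / n` has the stable
    -- count and fewer than `n` new elements.
    rw [← hd (max d (y / n)) (le_max_left _ _)]
    exact newCount_lt_of_ne_eq hn hθ hxy h (le_max_right _ _)
  obtain ⟨j, b, hc, hcl⟩ := exists_isPresentationCode hn hθ hd hlt
  exact ⟨_, j, d, b, hc, id, fun _ => rfl, fun x y => (hcl x y).1, fun y => ⟨y, hθ.rfl⟩⟩

/-! ### The order on the codes of ordinals -/

theorem omega_mul_add_lt {k j k' j' : ℕ} (h : k < k' ∨ k = k' ∧ j < j') :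
    Ordinal.omega0 * (k : Ordinal.{0}) + j < Ordinal.omega0 * (k' : Ordinal.{0}) + j' := by
  rcases h with h | ⟨rfl, h⟩
  · calc Ordinal.omega0 * (k : Ordinal.{0}) + (j : Ordinal.{0})
        < Ordinal.omega0 * (k : Ordinal.{0}) + Ordinal.omega0 := by
          gcongr; exact Ordinal.natCast_lt_omega0 _
      _ = Ordinal.omega0 * ((k + 1 : ℕ) : Ordinal.{0}) := by
          push_cast; rw [mul_add, mul_one]
      _ ≤ Ordinal.omega0 * (k' : Ordinal.{0}) := by
          gcongr; exact_mod_cast h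
      _ ≤ _ := le_self_add
  · gcongr

section

variable {n : ℕ} {h : OrdinalCoding (Ordinal.omega0 * (n : Ordinal.{0}))}

/-- `a` is the code of the ordinal `ω * k + j`. -/
def Denotes (h : OrdinalCoding (Ordinal.omega0 * (n : Ordinal.{0})))
    (a k j : ℕ) : Prop := (h.equiv a).1 = cnfPair k j

theorem exists_denotes (h : OrdinalCoding (Ordinal.omega0 * (n : Ordinal.{0})))
    (a : ℕ) : ∃ k j, k < n ∧ Denotes h a k j :=
  exists_cnfPair (h.equiv a).2.1 (h.equiv a).2.2

theorem Denotes.value {a k j : ℕ} (ha : Denotes h a k j) :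
    cnfValue (h.equiv a).1 = Ordinal.omega0 * (k : Ordinal.{0}) + j := by
  rw [ha, cnfValue_cnfPair]

theorem Denotes.unique {a k j k' j' : ℕ} (ha : Denotes h a k j) (ha' : Denotes h a k' j') :
    k = k' ∧ j = j' :=
  omega_mul_add_inj (ha.value.symm.trans ha'.value)

theorem Denotes.lt {a k j : ℕ} (ha : Denotes h a k j) : k < n := by
  obtain ⟨k', j', hk, ha'⟩ := exists_denotes h a
  rwa [(ha.unique ha').1]

theorem exists_code (h : OrdinalCoding (Ordinal.omega0 * (n : Ordinal.{0})))
    {k : ℕ} (hk : k < n) (j : ℕ) : ∃ a, Denotes h a k j := by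
  have hlt : cnfValue (cnfPair k j) < Ordinal.omega0 * (n : Ordinal.{0}) := by
    rw [cnfValue_cnfPair]
    simpa using omega_mul_add_lt (j := j) (j' := 0) (.inl hk)
  exact ⟨h.equiv.symm ⟨cnfPair k j, cnfPair_isCNF k j, hlt⟩, by simp [Denotes]⟩

theorem Denotes.le_iff {a b k j k' j' : ℕ} (ha : Denotes h a k j) (hb : Denotes h b k' j') :
    h.le a b ↔ ¬ (k' < k ∨ k' = k ∧ j' < j) := by
  rw [OrdinalCoding.le, ha.value, hb.value]
  refine ⟨fun hle hlt => (omega_mul_add_lt hlt).not_ge hle, fun hlt => ?_⟩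
  by_cases heq : k = k' ∧ j = j'
  · rw [heq.1, heq.2]
  · exact (omega_mul_add_lt (by omega)).le

theorem exists_isLeastFor (h : OrdinalCoding (Ordinal.omega0 * (n : Ordinal.{0})))
    {S : Set ℕ} (hS : S.Nonempty) : ∃ a, IsLeastFor h.le S a := by
  have hwf : WellFounded fun a b : ℕ => cnfValue (h.equiv a).1 < cnfValue (h.equiv b).1 :=
    InvImage.wf _ Ordinal.lt_wf
  refine ⟨hwf.min S hS, hwf.min_mem S hS, fun b hb => ?_⟩
  exact not_lt.1 (hwf.not_lt_min S hb)

theorem eMin_of_eq (h : OrdinalCoding (Ordinal.omega0 * (n : Ordinal.{0})))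
    {e i : ℕ} (hW : W e = W i) : EMin h e i := by
  rcases (W e).eq_empty_or_nonempty with he | he
  · exact .inr ⟨he, hW ▸ he⟩
  · obtain ⟨a, ha⟩ := exists_isLeastFor h he
    exact .inl ⟨a, ha, hW ▸ ha⟩

theorem primrec_cnfPair : Primrec₂ cnfPair :=
  Primrec.list_append.comp ((primrec_cnfTerm 1).comp Primrec.fst)
    ((primrec_cnfTerm 0).comp Primrec.snd)

theorem rePred_denotes (h : OrdinalCoding (Ordinal.omega0 * (n : Ordinal.{0})))
    {α : Type*} [Primcodable α] {a k j : α → ℕ} (ha : Computable a)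
    (hk : Computable k) (hj : Computable j) : REPred fun x => Denotes h (a x) (k x) (j x) :=
  rePred_eq (h.computable.comp ha) (primrec_cnfPair.to_comp.comp hk hj)

end

/-! ### Enumerating the presentations that cover an algebra -/

theorem primrec_two_pow : Primrec fun m : ℕ => 2 ^ m := by
  have : Primrec fun m : ℕ => Nat.rec (motive := fun _ => ℕ) 1 (fun _ r => 2 * r) m :=
    Primrec.nat_rec₁ 1 (Primrec.nat_mul.comp (Primrec.const 2) Primrec.snd)
  refine this.of_eq fun m => ?_
  induction m with
  | zero => rfl
  | succ m ih => rw [pow_succ, ← ih]; exact Nat.mul_comm _ _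

theorem primrec_testBit : Primrec₂ Nat.testBit := by
  have : Primrec₂ fun b i : ℕ => decide (b / 2 ^ i % 2 = 1) :=
    (PrimrecRel.comp Primrec.eq (Primrec.nat_mod.comp (Primrec.nat_div.comp Primrec.fst
      (primrec_two_pow.comp Primrec.snd)) (Primrec.const 2)) (Primrec.const 1)).decide
  exact this.of_eq fun b i => Nat.testBit_eq_decide_div_mod_eq.symm

theorem primrec_window (n : ℕ) : Primrec₂ fun i d : ℕ => i + n * d :=
  Primrec.nat_add.comp Primrec.fst (Primrec.nat_mul.comp (Primrec.const n) Primrec.snd)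

theorem primrec_maskLen (n : ℕ) : Primrec (maskLen n) := by
  have h : Primrec fun d : ℕ => n * (d + 1) :=
    Primrec.nat_mul.comp (Primrec.const n) Primrec.succ
  exact (Primrec.nat_mul.comp h h).of_eq fun d => (sq _).symm

theorem primrecPred_admissible (n : ℕ) :
    PrimrecRel fun (k : ℕ) (x : ℕ × ℕ) => Admissible n k x.1 x.2 := by
  have h1 : PrimrecRel fun (s : ℕ) (x : ℕ × (ℕ × ℕ)) =>
      x.2.2.testBit (Nat.pair s (x.1 + n * x.2.1)) = false :=
    PrimrecRel.comp Primrec.eq (primrec_testBit.comp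
      (Primrec.snd.comp (Primrec.snd.comp Primrec.snd))
      (Primrec₂.natPair.comp Primrec.fst ((primrec_window n).comp (Primrec.fst.comp Primrec.snd)
        (Primrec.fst.comp (Primrec.snd.comp Primrec.snd))))) (Primrec.const false)
  have h2 : PrimrecRel fun (i : ℕ) (x : ℕ × ℕ) =>
      ∀ s < i + n * x.1, x.2.testBit (Nat.pair s (i + n * x.1)) = false := by
    refine (h1.forall_mem_list.comp (Primrec.list_range.comp ((primrec_window n).comp Primrec.fst
      (Primrec.fst.comp Primrec.snd))) Primrec.id).of_eq fun x => ?_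
    simp
  have h3 := Primrec.list_length.comp (h2.listFilter.comp (Primrec.const (List.range n))
    (Primrec.snd (α := ℕ) (β := ℕ × ℕ)))
  exact (Primrec.nat_le.comp h3 Primrec.fst).of_eq fun x => Iff.rfl

theorem primrecRel_isPresentationCode (n : ℕ) : PrimrecRel fun (x y : ℕ × ℕ) =>
    IsPresentationCode n x.1 x.2 y.1 y.2 := by
  have hk : Primrec fun z : (ℕ × ℕ) × (ℕ × ℕ) => z.1.1 := Primrec.fst.comp Primrec.fst
  have hj : Primrec fun z : (ℕ × ℕ) × (ℕ × ℕ) => z.1.2 := Primrec.snd.comp Primrec.fst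
  have hb : Primrec fun z : (ℕ × ℕ) × (ℕ × ℕ) => z.2.2 := Primrec.snd.comp Primrec.snd
  have hm : Primrec fun z : (ℕ × ℕ) × (ℕ × ℕ) => maskLen n z.2.1 :=
    (primrec_maskLen n).comp (Primrec.fst.comp Primrec.snd)
  refine PrimrecPred.and ?_ (PrimrecPred.and ?_ (PrimrecPred.and ?_ ?_))
  · exact Primrec.nat_lt.comp hk (Primrec.const n)
  · exact Primrec.nat_lt.comp hb (primrec_two_pow.comp hm)
  · exact PrimrecRel.comp Primrec.eq (Primrec.succ.comp (Primrec.nat_add.comp hj hb))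
      (primrec_two_pow.comp (Primrec.succ.comp hm))
  · exact (primrecPred_admissible n).comp hk Primrec.snd

/-- The homomorphism that maps the generators to the entries of `u`. -/
def listHom (n : ℕ) (u : List ℕ) (x : ℕ) : ℕ := u.getD (x % n) 0 + n * (x / n)

theorem primrec_listHom (n : ℕ) : Primrec₂ (listHom n) :=
  Primrec.nat_add.comp
    ((Primrec.list_getD 0).comp Primrec.fst (Primrec.nat_mod.comp Primrec.snd (Primrec.const n)))
    (Primrec.nat_mul.comp (Primrec.const n) (Primrec.nat_div.comp Primrec.snd (Primrec.const n)))

/-- A homomorphism is given by the images of the generators, and it suffices to check the finitely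
many coded identities and that each generator is reached. This makes covering a c.e. condition when
`θ` is c.e. The length of `u` is unrestricted because missing entries count as `0`. -/
theorem shiftOnto_mask_iff {n d b : ℕ} (hn : 1 ≤ n) (hb : b < 2 ^ maskLen n d) {θ : ℕ → ℕ → Prop}
    (hθ : IsShiftCong n θ) : ShiftOnto n (shiftCl n (maskRel b)) θ ↔
      ∃ u : List ℕ, (∀ i ∈ List.range (maskLen n d), b.testBit i = false ∨
        θ (listHom n u i.unpair.1) (listHom n u i.unpair.2)) ∧
        ∀ y ∈ List.range n, ∃ x, θ (listHom n u x) y := by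
  constructor
  · rintro ⟨φ, h1, h2, h3⟩
    have hφ : ∀ x, listHom n ((List.range n).map φ) x = φ x := fun x => by
      rw [map_eq_mod_add h1, listHom]
      simp [List.getD, Nat.mod_lt x hn]
    refine ⟨(List.range n).map φ, fun i _ => ?_, fun y _ => ?_⟩
    · rw [hφ, hφ]
      cases hi : b.testBit i with
      | false => exact .inl rfl
      | true => exact .inr (h2 _ _ (shiftCl_of (by simpa [maskRel] using hi)))
    · obtain ⟨x, hx⟩ := h3 y
      exact ⟨x, by rwa [hφ]⟩
  · rintro ⟨u, h2, h3⟩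
    have h1 : ∀ x, listHom n u (x + n) = listHom n u x + n := fun x => by
      simp only [listHom, Nat.add_mod_right, Nat.add_div_right x hn]; ring
    have hker : IsShiftCong n fun x y => θ (listHom n u x) (listHom n u y) :=
      ⟨⟨fun _ => hθ.rfl, hθ.symm, hθ.trans⟩, fun h => by rw [h1, h1]; exact hθ.shift h⟩
    refine ⟨listHom n u, h1, fun x y => shiftCl_le hker fun x y hxy => ?_, fun y => ?_⟩
    · have hlt : Nat.pair x y < maskLen n d := by
        by_contra hlt
        rw [maskRel, Nat.testBit_lt_two_pow
          (hb.trans_le (Nat.pow_le_pow_right two_pos (not_lt.1 hlt)))] at hxy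
        exact absurd hxy (by simp)
      have := h2 _ (List.mem_range.2 hlt)
      rw [maskRel] at hxy
      simpa [hxy] using this
    · obtain ⟨x, hx⟩ := h3 (y % n) (List.mem_range.2 (Nat.mod_lt _ hn))
      refine ⟨x + n * (y / n), ?_⟩
      rw [map_add_mul h1]
      have := hθ.shift_mul hx (y / n)
      rwa [Nat.mod_add_div] at this

theorem rePred_coversAt {n : ℕ} (hn : 1 ≤ n) (c : IdentityCoding n) {α : Type*} [Primcodable α]
    {e k j : α → ℕ} (he : Computable e) (hk : Computable k) (hj : Computable j) :
    REPred fun a => CoversAt n (ceCong c (e a)) (k a) (j a) := by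
  have key : REPred fun a => ∃ d b, IsPresentationCode n (k a) (j a) d b ∧
      ∃ u : List ℕ, (∀ i ∈ List.range (maskLen n d), b.testBit i = false ∨
        ceCong c (e a) (listHom n u i.unpair.1) (listHom n u i.unpair.2)) ∧
        ∀ y ∈ List.range n, ∃ x, ceCong c (e a) (listHom n u x) y := by
    have hl := (primrec_listHom n).to_comp
    refine rePred_exists (rePred_exists (rePred_and ?_ (rePred_exists (rePred_and ?_ ?_))))
    · exact rePred_comp (rePred_of_primrec (primrecRel_isPresentationCode n))
        (((hk.comp (Computable.fst.comp Computable.fst)).pair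
          (hj.comp (Computable.fst.comp Computable.fst))).pair
          ((Computable.snd.comp Computable.fst).pair Computable.snd))
    · refine rePred_forall_mem (α := ((α × ℕ) × ℕ) × List ℕ) (β := ℕ)
        (p := fun z i => z.1.2.testBit i = false ∨ ceCong c (e z.1.1.1)
          (listHom n z.2 i.unpair.1) (listHom n z.2 i.unpair.2))
        (l := fun z => List.range (maskLen n z.1.1.2)) (rePred_or ?_ ?_) ?_
      · exact rePred_eq (primrec_testBit.to_comp.comp
          (Computable.snd.comp (Computable.fst.comp Computable.fst)) Computable.snd)
          (Computable.const false)
      · have hu := Primrec.unpair.to_comp.comp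
          (Computable.snd (α := ((α × ℕ) × ℕ) × List ℕ) (β := ℕ))
        have hz : Computable fun z : (((α × ℕ) × ℕ) × List ℕ) × ℕ => z.1.2 :=
          Computable.snd.comp Computable.fst
        exact rePred_ceCong c (he.comp (Computable.fst.comp (Computable.fst.comp
          (Computable.fst.comp Computable.fst)))) (hl.comp hz (Computable.fst.comp hu))
          (hl.comp hz (Computable.snd.comp hu))
      · exact Primrec.list_range.to_comp.comp ((primrec_maskLen n).to_comp.comp
          (Computable.snd.comp (Computable.fst.comp Computable.fst)))
    · refine rePred_forall_mem (α := ((α × ℕ) × ℕ) × List ℕ) (β := ℕ)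
        (p := fun z y => ∃ x, ceCong c (e z.1.1.1) (listHom n z.2 x) y)
        (l := fun _ => List.range n) (rePred_exists ?_) (Computable.const _)
      exact rePred_ceCong c (he.comp (Computable.fst.comp (Computable.fst.comp
        (Computable.fst.comp (Computable.fst.comp Computable.fst)))))
        (hl.comp (Computable.snd.comp (Computable.fst.comp Computable.fst)) Computable.snd)
        (Computable.snd.comp Computable.fst)
  refine key.of_eq fun a => exists_congr fun d => exists_congr fun b => and_congr_right fun h => ?_
  exact (shiftOnto_mask_iff hn h.2.1 (isShiftCong_ceCong c (e a))).symm

/-! ### Reduction of isomorphism to least elements. -/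

theorem isoUF_reducible_eMin {n : ℕ} (hn : 1 ≤ n) (c : IdentityCoding n)
    (h : OrdinalCoding (Ordinal.omega0 * (n : Ordinal.{0}))) :
    ComputablyReducible (IsoUF c) (EMin h) := by
  have hre : REPred fun x : ℕ × ℕ =>
      ∃ k j, Denotes h x.2 k j ∧ CoversAt n (ceCong c x.1) k j := by
    have hk : Computable fun z : ((ℕ × ℕ) × ℕ) × ℕ => z.1.2 := Computable.snd.comp Computable.fst
    have hx : Computable fun z : ((ℕ × ℕ) × ℕ) × ℕ => z.1.1 := Computable.fst.comp Computable.fst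
    exact rePred_exists (rePred_exists (rePred_and
      (rePred_denotes h (Computable.snd.comp hx) hk Computable.snd)
      (rePred_coversAt hn c (Computable.fst.comp hx) hk Computable.snd)))
  obtain ⟨r, hr, hW⟩ := exists_computable_W_eq
    (p := fun e a => ∃ k j, Denotes h a k j ∧ CoversAt n (ceCong c e) k j) hre
  refine ⟨r, hr, fun e i => ?_⟩
  have hce := isShiftCong_ceCong c e
  have hci := isShiftCong_ceCong c i
  rw [isoUF_iff hn]
  constructor
  · intro hiso
    refine eMin_of_eq h ?_
    rw [hW, hW]
    ext a
    exact exists_congr fun k => exists_congr fun j => and_congr_right fun _ =>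
      ⟨CoversAt.of_iso hci hiso, CoversAt.of_iso hce (hiso.symm hn hci)⟩
  · have hmin : ∀ {e a k j}, IsLeastFor h.le (W (r e)) a → Denotes h a k j →
        CoversAt n (ceCong c e) k j ∧
        ∀ k' j', CoversAt n (ceCong c e) k' j' → ¬ (k' < k ∨ k' = k ∧ j' < j) := by
      rintro e a k j ⟨hmem, hle⟩ ha
      rw [hW] at hmem hle
      obtain ⟨k', j', ha', hcov⟩ := hmem
      obtain ⟨rfl, rfl⟩ := ha'.unique ha
      refine ⟨hcov, fun k₁ j₁ hcov₁ => ?_⟩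
      have hk₁ : k₁ < n := by obtain ⟨d, b, hcode, -⟩ := hcov₁; exact hcode.1
      obtain ⟨b, hb⟩ := exists_code h hk₁ j₁
      exact (ha.le_iff hb).1 (hle b ⟨k₁, j₁, hb, hcov₁⟩)
    -- A congruence other than equality is covered by its own presentation, so no code at all forces
    -- the free algebra.
    have hempty : ∀ {e}, W (r e) = ∅ → ∀ x y, ceCong c e x y ↔ x = y := by
      intro e he x y
      refine ⟨fun hxy => ?_, fun hxy => hxy ▸ (isShiftCong_ceCong c e).rfl⟩
      by_contra hne
      obtain ⟨k, j, hcov⟩ := exists_coversAt hn (isShiftCong_ceCong c e) hne hxy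
      have hk : k < n := by obtain ⟨d, b, hcode, -⟩ := hcov; exact hcode.1
      obtain ⟨a, ha⟩ := exists_code h hk j
      have : a ∈ W (r e) := by rw [hW]; exact ⟨k, j, ha, hcov⟩
      rw [he] at this
      exact this
    rintro (⟨a, hea, hia⟩ | ⟨he, hi⟩)
    · obtain ⟨k, j, -, ha⟩ := exists_denotes h a
      obtain ⟨hcov, hm⟩ := hmin hea ha
      obtain ⟨hcov', hm'⟩ := hmin hia ha
      obtain ⟨d, b, hcode, -⟩ := id hcov
      have h1 := shiftIso_of_minimal hn hce hcode hcov hm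
      have h2 := shiftIso_of_minimal hn hci hcode hcov' hm'
      exact (h1.symm hn hce).trans hci h2
    · exact ⟨id, fun _ => rfl, fun x y => (hempty he x y).trans (hempty hi x y).symm,
        fun y => ⟨y, hci.rfl⟩⟩

/-! ### Algebras with free generators and a finite tail -/

/-- The identities `f^(j+1)(xₖ) = f^j(xₖ)` and `xᵢ = f^j(xₖ)` for `i > k`. -/
def tailRel (n k j x y : ℕ) : Prop :=
  (x = k + n * (j + 1) ∨ k < x ∧ x < n) ∧ y = k + n * j

/-- The normal form of `x` with respect to the identities `tailRel n k j`. -/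
def tailNF (n k j x : ℕ) : ℕ :=
  if x % n < k then x else if x % n = k then k + n * min (x / n) j else k + n * j

theorem tailNF_add_mul {n k j i d : ℕ} (hi : i < n) : tailNF n k j (i + n * d) =
    if i < k then i + n * d else if i = k then k + n * min d j else k + n * j := by
  rw [tailNF, Nat.add_mul_mod_self_left, Nat.mod_eq_of_lt hi,
    Nat.add_mul_div_left _ _ (by omega : 0 < n), Nat.div_eq_of_lt hi, zero_add]

theorem tailNF_of_lt {n k j x : ℕ} (h : x % n < k) : tailNF n k j x = x := if_pos h

theorem tailNF_eq_iff_of_lt {n k j i z : ℕ} (hn : 1 ≤ n) (hi : i < k) (hin : i < n) :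
    tailNF n k j z = tailNF n k j i ↔ z = i := by
  refine ⟨fun h => ?_, fun h => h ▸ rfl⟩
  rw [tailNF_of_lt (x := i) (by rwa [Nat.mod_eq_of_lt hin])] at h
  by_cases hz : z % n < k
  · rwa [tailNF_of_lt hz] at h
  · have := Nat.mod_lt z hn
    rw [tailNF, if_neg hz] at h
    split_ifs at h <;> omega

/-- With `tailNF_unstable`, this separates the tail from the free generators by a property that
isomorphisms preserve: whether iterating the operation reaches a fixed point. -/
theorem tailNF_stable {n k j : ℕ} (hn : 1 ≤ n) {x : ℕ} (hx : k ≤ x % n) {d : ℕ} (hd : j ≤ d) :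
    tailNF n k j (x + n * d) = k + n * j := by
  have hd' : j ≤ x / n + d := hd.trans (Nat.le_add_left _ _)
  have : x + n * d = x % n + n * (x / n + d) := by
    rw [Nat.mul_add, ← Nat.add_assoc, Nat.mod_add_div]
  rw [this, tailNF_add_mul (Nat.mod_lt _ hn), if_neg (by omega), min_eq_right hd', ite_self]

theorem tailNF_unstable {n k j : ℕ} (hn : 1 ≤ n) {x : ℕ} (hx : x % n < k) (d : ℕ) :
    tailNF n k j (x + n * d) ≠ tailNF n k j (x + n * (d + 1)) := by
  rw [tailNF_of_lt (by simpa using hx), tailNF_of_lt (by simpa using hx), Nat.mul_succ]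
  omega

theorem isShiftCong_tailNF {n : ℕ} (hn : 1 ≤ n) (k j : ℕ) :
    IsShiftCong n fun x y => tailNF n k j x = tailNF n k j y := by
  refine ⟨⟨fun _ => rfl, Eq.symm, Eq.trans⟩, fun {x y} hxy => ?_⟩
  -- The operation of the quotient, computed on normal forms.
  let g : ℕ → ℕ := fun z => if z % n < k then z + n else k + n * min (z / n + 1) j
  have hg : ∀ z, tailNF n k j (z + n) = g (tailNF n k j z) := by
    intro z
    have hlt := Nat.mod_lt z hn
    have hz : z = z % n + n * (z / n) := (Nat.mod_add_div z n).symm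
    have hz' : z + n = z % n + n * (z / n + 1) := by rw [Nat.mul_succ]; omega
    generalize z % n = i at *
    generalize z / n = q at *
    rw [hz', hz, tailNF_add_mul hlt, tailNF_add_mul hlt]
    rcases lt_or_ge i k with hi | hi
    · simp only [g, if_pos hi, Nat.add_mul_mod_self_left, Nat.mod_eq_of_lt hlt]
      ring
    · have hk : k < n := by omega
      have hgk : ∀ p, g (k + n * p) = k + n * min (p + 1) j := fun p => by
        simp only [g, Nat.add_mul_mod_self_left, Nat.mod_eq_of_lt hk, lt_irrefl, if_false,
          Nat.add_mul_div_left _ _ hn, Nat.div_eq_of_lt hk, zero_add]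
      rw [if_neg hi.not_gt, if_neg hi.not_gt]
      split_ifs
      · rw [hgk]
        congr 2; omega
      · rw [hgk]
        congr 2; omega
  change tailNF n k j (x + n) = tailNF n k j (y + n)
  rw [hg, hg, hxy]

/-- The pairs of `tailRel n k j` reduce every number to its normal form, and further pairs of `R` do
no harm if they respect normal forms. Requiring the pairs only for `k < n` lets `k = n` describe the
free algebra. -/
theorem shiftCl_iff_tailNF {n k j : ℕ} (hn : 1 ≤ n) {R : ℕ → ℕ → Prop}
    (hR : k < n → ∀ x y, tailRel n k j x y → R x y)
    (hR' : ∀ x y, R x y → tailNF n k j x = tailNF n k j y) (x y : ℕ) :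
    shiftCl n R x y ↔ tailNF n k j x = tailNF n k j y := by
  have hc := isShiftCong_shiftCl n R
  refine ⟨shiftCl_le (isShiftCong_tailNF hn k j) hR', ?_⟩
  have hnf : ∀ x, shiftCl n R x (tailNF n k j x) := by
    intro x
    have hlt := Nat.mod_lt x hn
    have hx : x = x % n + n * (x / n) := (Nat.mod_add_div x n).symm
    generalize x % n = i at *
    generalize x / n = q at *
    rw [hx, tailNF_add_mul hlt]
    rcases lt_or_ge i k with hi | hi
    · rw [if_pos hi]; exact hc.rfl
    rw [if_neg hi.not_gt]
    have hk : k < n := by omega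
    have hloop : ∀ p, shiftCl n R (k + n * (j + p)) (k + n * j) := by
      intro p
      induction p with
      | zero => exact hc.rfl
      | succ p ih =>
        have h1 := hc.shift ih
        have h2 : shiftCl n R (k + n * (j + 1)) (k + n * j) :=
          shiftCl_of (hR hk _ _ ⟨.inl rfl, rfl⟩)
        refine hc.trans ?_ h2
        convert h1 using 1 <;> ring
    split_ifs with hik
    · subst hik
      rcases le_total q j with hq | hq
      · rw [min_eq_left hq]; exact hc.rfl
      · obtain ⟨p, rfl⟩ := Nat.exists_eq_add_of_le hq
        rw [min_eq_right hq]
        exact hloop p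
    · have h1 : shiftCl n R i (k + n * j) :=
        shiftCl_of (hR hk _ _ ⟨.inr ⟨by omega, hlt⟩, rfl⟩)
      refine hc.trans (hc.shift_mul h1 q) ?_
      convert hloop q using 1; ring
  intro h
  exact hc.trans (hnf x) (h ▸ hc.symm (hnf y))

theorem tailNF_eq_of_tailRel {n k j k' j' x y : ℕ} (hk' : k' < n)
    (hle : ¬ (k' < k ∨ k' = k ∧ j' < j)) (h : tailRel n k' j' x y) :
    tailNF n k j x = tailNF n k j y := by
  obtain ⟨hx, rfl⟩ := h
  have hy : tailNF n k j (k' + n * j') = k + n * j := by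
    rw [tailNF_add_mul hk', if_neg (by omega)]
    split_ifs
    · rw [min_eq_right (by omega)]
    · rfl
  rw [hy]
  rcases hx with rfl | ⟨hx, hxn⟩
  · rw [tailNF_add_mul hk', if_neg (by omega)]
    split_ifs
    · rw [min_eq_right (by omega)]
    · rfl
  · have := tailNF_add_mul (k := k) (j := j) (d := 0) hxn
    rw [Nat.mul_zero, Nat.add_zero] at this
    rw [this, if_neg (by omega), if_neg (by omega)]

/-- An isomorphism does not increase the number of free generators. -/
theorem rank_le_of_shiftIso {n k j k' j' : ℕ} (hn : 1 ≤ n) (hk' : k' ≤ n)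
    (h : ShiftIso n (fun x y => tailNF n k j x = tailNF n k j y)
      fun x y => tailNF n k' j' x = tailNF n k' j' y) : k' ≤ k := by
  obtain ⟨φ, h1, h2, h3⟩ := h
  beta_reduce at h2 h3
  -- A free generator `i` is alone in its class, so a preimage `x` satisfies `φ x = i` exactly. Then
  -- `x` is a generator, since otherwise `φ x ≥ n`, and it is free, since otherwise its orbit would
  -- become stationary but that of `i` does not.
  have hsub : Finset.range k' ⊆ (Finset.range k).image φ := by
    intro i hi
    rw [Finset.mem_range] at hi
    obtain ⟨x, hx⟩ := h3 i
    rw [tailNF_eq_iff_of_lt hn hi (by omega)] at hx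
    have hxn : x < n := by
      have := map_eq_mod_add h1 x
      rw [hx] at this
      by_contra hlt
      have hq : 1 ≤ x / n := (Nat.le_div_iff_mul_le hn).2 (by omega)
      have := Nat.le_mul_of_pos_right n hq
      omega
    refine Finset.mem_image.2 ⟨x, Finset.mem_range.2 ?_, hx⟩
    by_contra hxk
    have hmod : k ≤ x % n := by rw [Nat.mod_eq_of_lt hxn]; omega
    have hst : tailNF n k j (x + n * j) = tailNF n k j (x + n * (j + 1)) := by
      rw [tailNF_stable hn hmod le_rfl, tailNF_stable hn hmod (Nat.le_succ j)]
    rw [h2, map_add_mul h1, map_add_mul h1, hx] at hst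
    exact tailNF_unstable hn (by rwa [Nat.mod_eq_of_lt (by omega : i < n)]) _ hst
  have := (Finset.card_le_card hsub).trans Finset.card_image_le
  rwa [Finset.card_range, Finset.card_range] at this

/-- An isomorphism does not decrease the length of the tail. -/
theorem tail_le_of_shiftIso {n k j j' : ℕ} (hn : 1 ≤ n) (hk : k < n)
    (h : ShiftIso n (fun x y => tailNF n k j x = tailNF n k j y)
      fun x y => tailNF n k j' x = tailNF n k j' y) : j ≤ j' := by
  obtain ⟨φ, h1, h2, -⟩ := h
  beta_reduce at h2
  have hmod : k ≤ k % n := by rw [Nat.mod_eq_of_lt hk]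
  -- The orbit of `xₖ` becomes stationary, so its image cannot lie above a free generator.
  have hz : k ≤ φ k % n := by
    by_contra hz
    have hst : tailNF n k j (k + n * j) = tailNF n k j (k + n * (j + 1)) := by
      rw [tailNF_stable hn hmod le_rfl, tailNF_stable hn hmod (Nat.le_succ j)]
    rw [h2, map_add_mul h1, map_add_mul h1] at hst
    exact tailNF_unstable hn (not_le.1 hz) _ hst
  -- In the target every such orbit is stationary after `j'` steps; pulled back along `φ`, this
  -- bounds the tail of the source.
  have hst : tailNF n k j (k + n * j') = tailNF n k j (k + n * (j' + 1)) := by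
    rw [h2, map_add_mul h1, map_add_mul h1, tailNF_stable hn hz le_rfl,
      tailNF_stable hn hz (Nat.le_succ j')]
  rw [tailNF_add_mul hk, tailNF_add_mul hk, if_neg (lt_irrefl k), if_neg (lt_irrefl k),
    if_pos rfl, if_pos rfl] at hst
  have := Nat.eq_of_mul_eq_mul_left hn (Nat.add_left_cancel hst)
  omega

theorem rePred_tailRel (n : ℕ) {α : Type*} [Primcodable α] {k j x y : α → ℕ} (hk : Computable k)
    (hj : Computable j) (hx : Computable x) (hy : Computable y) :
    REPred fun a => tailRel n (k a) (j a) (x a) (y a) := by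
  have hw := (primrec_window n).to_comp
  have hlt : ∀ {f g : α → ℕ}, Computable f → Computable g → REPred fun a => f a < g a :=
    fun hf hg => rePred_comp (rePred_of_primrec Primrec.nat_lt) (hf.pair hg)
  exact rePred_and (rePred_or (rePred_eq hx (hw.comp hk (Computable.succ.comp hj)))
    (rePred_and (hlt hk hx) (hlt hx (Computable.const n)))) (rePred_eq hy (hw.comp hk hj))

/-! ### Reduction of least elements to isomorphism. -/

theorem eMin_reducible_isoUF {n : ℕ} (hn : 1 ≤ n) (c : IdentityCoding n)
    (h : OrdinalCoding (Ordinal.omega0 * (n : Ordinal.{0}))) :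
    ComputablyReducible (EMin h) (IsoUF c) := by
  have hre : REPred fun x : ℕ × ℕ => ∃ a k j, a ∈ W x.1 ∧ Denotes h a k j ∧
      tailRel n k j (c.equiv x.2).1.toNat (c.equiv x.2).2.toNat := by
    have hk : Computable fun z : (((ℕ × ℕ) × ℕ) × ℕ) × ℕ => z.1.2 :=
      Computable.snd.comp Computable.fst
    have ha : Computable fun z : (((ℕ × ℕ) × ℕ) × ℕ) × ℕ => z.1.1.2 :=
      Computable.snd.comp (Computable.fst.comp Computable.fst)
    have hx : Computable fun z : (((ℕ × ℕ) × ℕ) × ℕ) × ℕ => z.1.1.1 :=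
      Computable.fst.comp (Computable.fst.comp Computable.fst)
    have hc := c.computable.comp (Computable.snd.comp hx)
    have ht := (primrec_toNat n).to_comp
    exact rePred_exists (rePred_exists (rePred_exists (rePred_and
      (rePred_mem_W ha (Computable.fst.comp hx)) (rePred_and (rePred_denotes h ha hk Computable.snd)
      (rePred_tailRel n hk Computable.snd (ht.comp (Computable.fst.comp hc))
        (ht.comp (Computable.snd.comp hc)))))))
  obtain ⟨r, hr, hW⟩ := exists_computable_W_eq (p := fun e i => ∃ a k j, a ∈ W e ∧
    Denotes h a k j ∧ tailRel n k j (c.equiv i).1.toNat (c.equiv i).2.toNat) hre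
  have hrel : ∀ e x y, identityRel (c.equiv '' W (r e)) x y ↔
      ∃ a k j, a ∈ W e ∧ Denotes h a k j ∧ tailRel n k j x y := by
    intro e x y
    rw [identityRel, Set.exists_mem_image, hW]
    constructor
    · rintro ⟨i, hi, rfl, rfl⟩
      exact hi
    · intro hxy
      obtain ⟨s, rfl⟩ := (UTerm.toNat_bijective hn).2 x
      obtain ⟨t, rfl⟩ := (UTerm.toNat_bijective hn).2 y
      exact ⟨c.equiv.symm (s, t), by simpa using hxy, by simp, by simp⟩
  have hempty : ∀ {e}, W e = ∅ → ∀ x y, ceCong c (r e) x y ↔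
      tailNF n n 0 x = tailNF n n 0 y := by
    intro e he
    refine shiftCl_iff_tailNF hn (fun hlt => absurd hlt (lt_irrefl n)) fun x y hxy => ?_
    obtain ⟨a, k, j, ha, -⟩ := (hrel e x y).1 hxy
    rw [he] at ha
    exact absurd ha (Set.notMem_empty a)
  have hleast : ∀ {e a k j}, IsLeastFor h.le (W e) a → Denotes h a k j →
      ∀ x y, ceCong c (r e) x y ↔ tailNF n k j x = tailNF n k j y := by
    rintro e a k j ⟨hmem, hle⟩ ha
    refine shiftCl_iff_tailNF hn (fun _ x y hxy => (hrel e x y).2 ⟨a, k, j, hmem, ha, hxy⟩)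
      fun x y hxy => ?_
    obtain ⟨b, k', j', hb, hb', hxy⟩ := (hrel e x y).1 hxy
    exact tailNF_eq_of_tailRel hb'.lt ((ha.le_iff hb').1 (hle b hb)) hxy
  -- The empty set is treated as rank `k = n`, so comparing ranks also separates it from the
  -- nonempty sets.
  have hform : ∀ e, ∃ k j, (∀ x y, ceCong c (r e) x y ↔ tailNF n k j x = tailNF n k j y) ∧
      (W e = ∅ ∧ k = n ∨ k < n ∧ ∃ a, IsLeastFor h.le (W e) a ∧ Denotes h a k j) := by
    intro e
    rcases (W e).eq_empty_or_nonempty with he | he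
    · exact ⟨n, 0, hempty he, .inl ⟨he, rfl⟩⟩
    · obtain ⟨a, ha⟩ := exists_isLeastFor h he
      obtain ⟨k, j, hk, hd⟩ := exists_denotes h a
      exact ⟨k, j, hleast ha hd, .inr ⟨hk, a, ha, hd⟩⟩
  have hsame : ∀ {e i k j}, (∀ x y, ceCong c (r e) x y ↔ tailNF n k j x = tailNF n k j y) →
      (∀ x y, ceCong c (r i) x y ↔ tailNF n k j x = tailNF n k j y) →
      ShiftIso n (ceCong c (r e)) (ceCong c (r i)) := fun he hi =>
    ⟨id, fun _ => rfl, fun x y => (he x y).trans (hi x y).symm,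
      fun y => ⟨y, (isShiftCong_ceCong c _).rfl⟩⟩
  refine ⟨r, hr, fun e i => ?_⟩
  rw [isoUF_iff hn]
  constructor
  · rintro (⟨a, hea, hia⟩ | ⟨he, hi⟩)
    · obtain ⟨k, j, -, ha⟩ := exists_denotes h a
      exact hsame (hleast hea ha) (hleast hia ha)
    · exact hsame (hempty he) (hempty hi)
  · intro hiso
    have hsymm := hiso.symm hn (isShiftCong_ceCong c _)
    obtain ⟨k, j, hcl, hcase⟩ := hform e
    obtain ⟨k', j', hcl', hcase'⟩ := hform i
    rw [show ceCong c (r e) = fun x y => tailNF n k j x = tailNF n k j y from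
      funext fun x => funext fun y => propext (hcl x y),
      show ceCong c (r i) = fun x y => tailNF n k' j' x = tailNF n k' j' y from
      funext fun x => funext fun y => propext (hcl' x y)] at hiso hsymm
    have hkk : k = k' := le_antisymm
      (rank_le_of_shiftIso hn (by rcases hcase with hc | hc <;> omega) hsymm)
      (rank_le_of_shiftIso hn (by rcases hcase' with hc | hc <;> omega) hiso)
    subst hkk
    rcases hcase with ⟨he, rfl⟩ | ⟨hk, a, ha, hd⟩ <;>
      rcases hcase' with ⟨hi, hk'⟩ | ⟨hk', b, hb, hd'⟩
    · exact .inr ⟨he, hi⟩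
    · exact absurd hk' (lt_irrefl _)
    · omega
    · have hjj : j = j' := le_antisymm (tail_le_of_shiftIso hn hk hiso)
        (tail_le_of_shiftIso hn hk hsymm)
      subst hjj
      have hab : a = b := h.equiv.injective (Subtype.ext (hd.trans hd'.symm))
      exact .inl ⟨a, ha, hab ▸ hb⟩

end CEAlg

theorem mainTheorem3 (n : ℕ) (hn : 1 ≤ n) (c : CEAlg.IdentityCoding n)
    (h : CEAlg.OrdinalCoding (Ordinal.omega0 * (n : Ordinal.{0}))) :
    CEAlg.ComputablyBireducible (CEAlg.IsoUF c) (CEAlg.EMin h) :=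
  ⟨CEAlg.isoUF_reducible_eMin hn c h, CEAlg.eMin_reducible_isoUF hn c h⟩
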